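/- Let $k\ge 1$. For $n=(n_1,\dots,n_k)\in\mathbb{N}^k$ let $\mathcal{H}_n=\mathbb{C}^{n_1}\otimes\cdots\otimes\mathbb{C}^{n_k}$ with the natural action of $LU_n=U(n_1)\times\cdots\times U(n_k)$, and let $I_{k,n}$ be the complex algebra of $LU_n$-invariant functions $\mathcal{H}_n\to\mathbb{C}$ that are polynomials in the coefficients $\psi_{i_1,\dots,i_k}$ of $\psi\in\mathcal{H}_n$ and their complex conjugates. It is graded by calling homogeneous of degree $m$ the functions that are homogeneous of degree $m$ in the coefficients and homogeneous of degree $m$ in their conjugates (so of total degree $2m$). For $n\le n'$ componentwise, the inclusions $\mathbb{C}^{n_i}\hookrightarrow\mathbb{C}^{n_i'}$ into the first coordinates induce $\iota_{n,n'}:\mathcal{H}_n\hookrightarrow\mathcal{H}_{n'}$ and the restriction maps $\varrho_{n,n'}:I_{k,n'}\to I_{k,n}$, $f\mapsto f\circ\iota_{n,n'}$. Let $I_k=\varprojlim_n I_{k,n}$ be the inverse limit in the category of graded algebras, that is, the algebra of all families $(f_n)_n\in\prod_n I_{k,n}$ with $f_n=\varrho_{n,n'}f_{n'}$ for all $n\le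 n'$ for which the degrees of the $f_n$ are bounded. For $\sigma=(\sigma_1,\dots,\sigma_{k-1})\in S_m^{k-1}$ put $$f_{[\sigma]}(\psi)=\sum_{i}\ \prod_{l=1}^m\psi_{i^l_1,\dots,i^l_k}\ \prod_{l=1}^m\overline{\psi_{i_1^{\sigma_1(l)},\dots,i_{k-1}^{\sigma_{k-1}(l)},i_k^l}}\qquad(\psi\in\mathcal{H}_n),$$ the sum being over all $i^l_j\in\{1,\dots,n_j\}$, $1\le l\le m$, $1\le j\le k$; this depends only on the orbit $[\sigma]$ of $\sigma$ under simultaneous conjugation by $S_m$. Let $G$ be the directed graph with one vertex and $k-1$ loops of distinct colours. A covering of $G$ is a nonempty directed graph with edges coloured by these $k-1$ colours in which every vertex has, for each colour, exactly one outgoing and exactly one incoming edge of that colour, with its unique colour-preserving projection to $G$; it is finite, resp. $m$-fold, if it has finitely many, resp. $m$, vertices. Let $\mathrm{Iso}_c(G)$ be the set of isomorphism classes of finite connected coverings of $G$. For an $m$-fold covering $\tilde G$ let $\Phi(\tilde G)\in S_m^{k-1}/S_m$ be the orbit of the tuple $(\sigma_1,\dots,\sigma_{k-1})$ obtained by numbering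 the vertices by $1,\dots,m$, where $\sigma_i(a)=b$ if there is an edge of colour $i$ from $a$ to $b$. Theorem. (1) $I_k$ is a free commutative $\mathbb{C}$-algebra, freely generated by the invariants $f_{\Phi(\tilde G)}$, $\tilde G\in\mathrm{Iso}_c(G)$ (for different $\tilde G$ these are different and algebraically independent, and they generate $I_k$). (2) $\Phi$ is a bijection from $\mathrm{Iso}_c(G)$ onto the set of orbits, for all $m\ge 1$, of tuples in $S_m^{k-1}$ that generate a transitive subgroup of $S_m$. (3) If $\tilde G$ is a connected $d$-fold covering, then $f_{\Phi(\tilde G)}$ is homogeneous of degree $d$, and for every $d\ge 1$ the number of elements of $F=\{f_{\Phi(\tilde G)}\mid\tilde G\in\mathrm{Iso}_c(G)\}$ that are homogeneous of degree $d$ (total degree $2d$) is finite and equals the number of conjugacy classes of subgroups of index $d$ in the free group $F_{k-1}$ on $k-1$ generators. -/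

import Mathlib

open scoped ComplexConjugate TensorProduct Pointwise

/-! ### Coloured directed graphs and their coverings -/

/-- A directed graph with coloured edges; multiple edges and loops are allowed. -/
structure ColouredGraph (C : Type) where
  V : Type
  E : Type
  tail : E → V
  head : E → V
  colour : E → C

namespace ColouredGraph

variable {C : Type}

/-- Number of edges of colour `c` starting at `v`. -/
noncomputable def outdegree (G : ColouredGraph C) (v : G.V) (c : C) : ℕ∞ :=
  {e : G.E | G.tail e = v ∧ G.colour e = c}.encard

/-- Number of edges of colour `c` ending at `v`. -/
noncomputable def indegree (G : ColouredGraph C) (v : G.V) (c : C) : ℕ∞ :=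
  {e : G.E | G.head e = v ∧ G.colour e = c}.encard

/-- Connectedness of the underlying undirected graph. -/
def Connected (G : ColouredGraph C) : Prop :=
  Nonempty G.V ∧
    ∀ u v : G.V, Relation.EqvGen (fun a b => ∃ e, G.tail e = a ∧ G.head e = b) u v

/-- The graph with a single vertex and `r` directed loops of pairwise different colours. -/
def rose (r : ℕ) : ColouredGraph (Fin r) where
  V := Unit
  E := Fin r
  tail := fun _ => ()
  head := fun _ => ()
  colour := id

/-- A covering with base `G`: the total graph together with the projection to `G`. -/
structure Covering (G : ColouredGraph C) where
  total : ColouredGraph C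
  projV : total.V → G.V
  projE : total.E → G.E
  projV_surjective : Function.Surjective projV
  projE_surjective : Function.Surjective projE
  tail_projE : ∀ e, G.tail (projE e) = projV (total.tail e)
  head_projE : ∀ e, G.head (projE e) = projV (total.head e)
  colour_projE : ∀ e, G.colour (projE e) = total.colour e
  outdegree_eq : ∀ v c, total.outdegree v c = G.outdegree (projV v) c
  indegree_eq : ∀ v c, total.indegree v c = G.indegree (projV v) c

namespace Covering

variable {G : ColouredGraph C}

/-- The covering has finite fibres over the vertices. -/
def IsFinite (X : Covering G) : Prop :=
  ∀ v : G.V, (X.projV ⁻¹' {v}).Finite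

/-- The covering is `m`-fold. -/
def IsFold (X : Covering G) (m : ℕ) : Prop :=
  ∀ v : G.V, (X.projV ⁻¹' {v}).encard = m

/-- Two coverings of `G` are isomorphic: there is an isomorphism of coloured directed graphs
between the total graphs that commutes with the projections. -/
def Isomorphic (X Y : Covering G) : Prop :=
  ∃ (a : X.total.V ≃ Y.total.V) (b : X.total.E ≃ Y.total.E),
    (∀ e, Y.total.tail (b e) = a (X.total.tail e)) ∧
    (∀ e, Y.total.head (b e) = a (X.total.head e)) ∧
    (∀ e, Y.total.colour (b e) = X.total.colour e) ∧
    (∀ v, Y.projV (a v) = X.projV v) ∧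
    (∀ e, Y.projE (b e) = X.projE e)

theorem Isomorphic.refl (X : Covering G) : Isomorphic X X :=
  ⟨Equiv.refl _, Equiv.refl _, by simp⟩

theorem Isomorphic.symm {X Y : Covering G} : Isomorphic X Y → Isomorphic Y X := by
  rintro ⟨a, b, h1, h2, h3, h4, h5⟩
  refine ⟨a.symm, b.symm, fun e => ?_, fun e => ?_, fun e => ?_, fun v => ?_, fun e => ?_⟩
  · rw [Equiv.eq_symm_apply, ← h1, Equiv.apply_symm_apply]
  · rw [Equiv.eq_symm_apply, ← h2, Equiv.apply_symm_apply]
  · rw [← h3, Equiv.apply_symm_apply]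
  · rw [← h4, Equiv.apply_symm_apply]
  · rw [← h5, Equiv.apply_symm_apply]

theorem Isomorphic.trans {X Y Z : Covering G} :
    Isomorphic X Y → Isomorphic Y Z → Isomorphic X Z := by
  rintro ⟨a, b, h1, h2, h3, h4, h5⟩ ⟨a', b', h1', h2', h3', h4', h5'⟩
  exact ⟨a.trans a', b.trans b', by simp_all⟩

end Covering

/-- Finite coverings of `G`. -/
def FiniteCovering (G : ColouredGraph C) : Type 1 := {X : Covering G // X.IsFinite}

instance FiniteCovering.setoid (G : ColouredGraph C) : Setoid (FiniteCovering G) where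
  r X Y := X.1.Isomorphic Y.1
  iseqv := ⟨fun X => .refl X.1, fun h => h.symm, fun h h' => h.trans h'⟩

/-- Isomorphism classes of finite coverings of `G`. -/
def Iso (G : ColouredGraph C) : Type 1 := Quotient (FiniteCovering.setoid G)

/-- Isomorphism classes of finite connected coverings of `G`. -/
def Isoc (G : ColouredGraph C) : Set (Iso G) :=
  {c | ∃ X : FiniteCovering G, X.1.total.Connected ∧ (Quotient.mk _ X : Iso G) = c}

/-- Isomorphism classes of connected `m`-fold coverings of `G`. -/
def IsocFold (G : ColouredGraph C) (m : ℕ) : Set (Iso G) :=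
  {c | ∃ X : FiniteCovering G, X.1.total.Connected ∧ X.1.IsFold m ∧
    (Quotient.mk _ X : Iso G) = c}

end ColouredGraph

/-! ### Tuples of permutations up to simultaneous conjugation -/

/-- The orbits of `r`-tuples of permutations of `m` letters under simultaneous conjugation. -/
abbrev PermOrbit (r m : ℕ) : Type :=
  MulAction.orbitRel.Quotient (ConjAct (Equiv.Perm (Fin m))) (Fin r → Equiv.Perm (Fin m))

/-- The orbit of a tuple of permutations. -/
def PermOrbit.mk {r m : ℕ} (σ : Fin r → Equiv.Perm (Fin m)) : PermOrbit r m :=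
  Quotient.mk _ σ

/-- The orbits of tuples that generate a transitive subgroup of the symmetric group on `m ≥ 1`
letters, for all `m`. -/
def transitiveOrbits (r : ℕ) : Set (Σ m : ℕ, PermOrbit r m) :=
  {s | ∃ (m : ℕ) (σ : Fin r → Equiv.Perm (Fin m)), 1 ≤ m ∧
    MulAction.IsPretransitive (Subgroup.closure (Set.range σ)) (Fin m) ∧
    s = ⟨m, PermOrbit.mk σ⟩}

theorem PermOrbit.mk_eq_of_conj {r m : ℕ} {σ τ : Fin r → Equiv.Perm (Fin m)}
    (π : Equiv.Perm (Fin m)) (h : ∀ i, σ i = π * τ i * π⁻¹) :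
    PermOrbit.mk σ = PermOrbit.mk τ :=
  Quotient.sound ⟨ConjAct.toConjAct π, by
    funext i; simp [ConjAct.smul_def, h]⟩

namespace ColouredGraph

variable {r : ℕ}

theorem Covering.exists_out (X : Covering (rose r)) (i : Fin r) (v : X.total.V) :
    ∃ e, {e : X.total.E | X.total.tail e = v ∧ X.total.colour e = i} = {e} := by
  rw [← Set.encard_eq_one]
  refine (X.outdegree_eq v i).trans ?_
  rw [outdegree, Set.encard_eq_one]
  exact ⟨i, by ext j; exact ⟨fun h => h.2, fun h => ⟨rfl, h⟩⟩⟩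

theorem Covering.exists_in (X : Covering (rose r)) (i : Fin r) (v : X.total.V) :
    ∃ e, {e : X.total.E | X.total.head e = v ∧ X.total.colour e = i} = {e} := by
  rw [← Set.encard_eq_one]
  refine (X.indegree_eq v i).trans ?_
  rw [indegree, Set.encard_eq_one]
  exact ⟨i, by ext j; exact ⟨fun h => h.2, fun h => ⟨rfl, h⟩⟩⟩

/-- The end point of the unique edge of colour `i` starting at `v`. -/
noncomputable def Covering.step (X : Covering (rose r)) (i : Fin r) (v : X.total.V) : X.total.V :=
  X.total.head (X.exists_out i v).choose

theorem Covering.step_eq_iff (X : Covering (rose r)) (i : Fin r) (v w : X.total.V) :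
    X.step i v = w ↔ ∃ e, X.total.tail e = v ∧ X.total.head e = w ∧ X.total.colour e = i := by
  have h := (X.exists_out i v).choose_spec
  have h0 : (X.exists_out i v).choose ∈
      {e : X.total.E | X.total.tail e = v ∧ X.total.colour e = i} :=
    h.ge rfl
  constructor
  · rintro rfl
    exact ⟨_, h0.1, rfl, h0.2⟩
  · rintro ⟨e, h1, h2, h3⟩
    have h4 : e ∈ {e : X.total.E | X.total.tail e = v ∧ X.total.colour e = i} := ⟨h1, h3⟩
    rw [h] at h4
    rw [Covering.step, ← h2, Set.mem_singleton_iff.1 h4]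

theorem Covering.step_bijective (X : Covering (rose r)) (i : Fin r) :
    Function.Bijective (X.step i) := by
  constructor
  · intro v w h
    obtain ⟨e, h1, h2, h3⟩ := (X.step_eq_iff i v _).1 rfl
    obtain ⟨e', h1', h2', h3'⟩ := (X.step_eq_iff i w _).1 h.symm
    obtain ⟨e0, h0⟩ := X.exists_in i (X.step i v)
    have he : e ∈ {e : X.total.E | X.total.head e = X.step i v ∧ X.total.colour e = i} := ⟨h2, h3⟩
    have he' : e' ∈ {e : X.total.E | X.total.head e = X.step i v ∧ X.total.colour e = i} :=
      ⟨h2', h3'⟩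
    rw [h0, Set.mem_singleton_iff] at he he'
    rw [← h1, ← h1', he, he']
  · intro w
    obtain ⟨e0, h0⟩ := X.exists_in i w
    have he : e0 ∈ {e : X.total.E | X.total.head e = w ∧ X.total.colour e = i} := by
      rw [h0]; simp
    exact ⟨X.total.tail e0, (X.step_eq_iff i _ _).2 ⟨e0, rfl, he.1, he.2⟩⟩

/-- The permutation of the vertices that sends `a` to `b` if there is an edge of colour `i` from
`a` to `b`. -/
noncomputable def Covering.monodromy (X : Covering (rose r)) (i : Fin r) :
    Equiv.Perm X.total.V :=
  Equiv.ofBijective (X.step i) (X.step_bijective i)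

theorem FiniteCovering.finite (X : FiniteCovering (rose r)) : Finite X.1.total.V := by
  exact Set.finite_univ_iff.1 ((X.2 ()).subset fun _ _ => rfl)

/-- A labelling of the vertices by `Fin m`, where `m` is the number of vertices. The resulting
orbit of permutations does not depend on it. -/
noncomputable def FiniteCovering.label (X : FiniteCovering (rose r)) :
    X.1.total.V ≃ Fin (Nat.card X.1.total.V) :=
  haveI := X.finite
  Finite.equivFin _

theorem orbit_label_eq {A B : Type} {m n : ℕ} (l : A ≃ Fin m) (l' : B ≃ Fin n) (a : A ≃ B)
    (f : Fin r → Equiv.Perm A) (g : Fin r → Equiv.Perm B) (h : ∀ i v, g i (a v) = a (f i v)) :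
    (⟨m, PermOrbit.mk fun i => l.permCongr (f i)⟩ : Σ m : ℕ, PermOrbit r m) =
      ⟨n, PermOrbit.mk fun i => l'.permCongr (g i)⟩ := by
  obtain rfl : m = n := by
    simpa using Fintype.card_congr ((l.symm.trans a).trans l')
  congr 1
  refine PermOrbit.mk_eq_of_conj ((l'.symm.trans a.symm).trans l) fun i => ?_
  ext x
  have : a.symm (g i (a (l.symm x))) = f i (l.symm x) := by rw [h, Equiv.symm_apply_apply]
  simp [Equiv.Perm.mul_apply, Equiv.Perm.inv_def, Equiv.permCongr_apply, this]

/-- The map `Φ` from isomorphism classes of finite coverings of the one-vertex graph to orbits of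
tuples of permutations: label the vertices and read off the permutations. -/
noncomputable def Phi (r : ℕ) : Iso (rose r) → Σ m : ℕ, PermOrbit r m :=
  Quotient.lift
    (fun X => ⟨Nat.card X.1.total.V,
      PermOrbit.mk fun i => X.label.permCongr (X.1.monodromy i)⟩) (by
    rintro X Y ⟨a, b, h1, h2, h3, -, -⟩
    refine orbit_label_eq _ _ a _ _ fun i v => ?_
    refine (Y.1.step_eq_iff i _ _).2 ?_
    obtain ⟨e, he1, he2, he3⟩ := (X.1.step_eq_iff i v _).1 rfl
    exact ⟨b e, by rw [h1, he1], by rw [h2, he2]; rfl, by rw [h3, he3]⟩)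

end ColouredGraph

/-! ### Complex-valued polynomial functions on a complex vector space -/

section PolynomialFunctions

variable (H : Type) [AddCommGroup H] [Module ℂ H]

/-- The linear functionals, as functions. -/
def linForms : Submodule ℂ (H → ℂ) where
  carrier := {f | ∃ l : H →ₗ[ℂ] ℂ, f = fun ψ => l ψ}
  add_mem' := by rintro _ _ ⟨l, rfl⟩ ⟨l', rfl⟩; exact ⟨l + l', rfl⟩
  zero_mem' := ⟨0, rfl⟩
  smul_mem' := by rintro c _ ⟨l, rfl⟩; exact ⟨c • l, rfl⟩

/-- The complex conjugates of linear functionals, as functions. -/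
def conjForms : Submodule ℂ (H → ℂ) where
  carrier := {f | ∃ l : H →ₗ[ℂ] ℂ, f = fun ψ => conj (l ψ)}
  add_mem' := by rintro _ _ ⟨l, rfl⟩ ⟨l', rfl⟩; exact ⟨l + l', by ext; simp⟩
  zero_mem' := ⟨0, by ext; simp⟩
  smul_mem' := by rintro c _ ⟨l, rfl⟩; exact ⟨conj c • l, by ext; simp⟩

/-- The algebra of functions that are polynomials in the coordinates and their conjugates. -/
def polyFun : Subalgebra ℂ (H → ℂ) :=
  Algebra.adjoin ℂ ((linForms H : Set (H → ℂ)) ∪ conjForms H)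

/-- Polynomial functions of total degree at most `N` in the coordinates and their conjugates:
the span of all products of `N` factors, each a constant, a linear functional or the conjugate of
a linear functional. -/
def polyFunLE (N : ℕ) : Submodule ℂ (H → ℂ) := (1 ⊔ linForms H ⊔ conjForms H) ^ N

/-- Polynomial functions that are homogeneous of degree `m` in the coordinates and homogeneous of
degree `m` in their conjugates. -/
def biHomogeneous (m : ℕ) : Submodule ℂ (H → ℂ) := linForms H ^ m * conjForms H ^ m

theorem polyFunLE_mono {N M : ℕ} (h : N ≤ M) : polyFunLE H N ≤ polyFunLE H M :=
  pow_le_pow_right' (le_sup_left.trans le_sup_left) h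

end PolynomialFunctions

/-! ### Local unitary invariants -/

/-- The state space `ℂ^{n_1} ⊗ ⋯ ⊗ ℂ^{n_k}`. -/
abbrev StateSpace {k : ℕ} (n : Fin k → ℕ) : Type := ⨂[ℂ] i, (Fin (n i) → ℂ)

/-- The local unitary group `U(n_1) × ⋯ × U(n_k)`. -/
abbrev LU {k : ℕ} (n : Fin k → ℕ) : Type := ∀ i, Matrix.unitaryGroup (Fin (n i)) ℂ

/-- The action of a local unitary transformation on the state space. -/
noncomputable def LU.act {k : ℕ} {n : Fin k → ℕ} (U : LU n) : StateSpace n →ₗ[ℂ] StateSpace n :=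
  PiTensorProduct.map fun i => Matrix.toLin' (U i : Matrix (Fin (n i)) (Fin (n i)) ℂ)

/-- The algebra `I_{k,n}` of local-unitary-invariant polynomial functions on the state space. -/
def LUInvariant {k : ℕ} (n : Fin k → ℕ) : Subalgebra ℂ (StateSpace n → ℂ) :=
  polyFun (StateSpace n) ⊓
    { carrier := {f | ∀ (U : LU n) (ψ : StateSpace n), f (U.act ψ) = f ψ}
      mul_mem' := fun hf hg U ψ => by simp [hf U ψ, hg U ψ]
      add_mem' := fun hf hg U ψ => by simp [hf U ψ, hg U ψ]
      algebraMap_mem' := fun _ _ _ => rfl }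

/-- The tensor product of the inclusions `ℂ^{n_i} → ℂ^{n'_i}` into the first coordinates. -/
noncomputable def stateIncl {k : ℕ} {n n' : Fin k → ℕ} (h : n ≤ n') :
    StateSpace n →ₗ[ℂ] StateSpace n' :=
  PiTensorProduct.map fun i => Function.ExtendByZero.linearMap ℂ (Fin.castLE (h i))

/-- The inverse limit `I_k` of the graded algebras `I_{k,n}`, in the category of graded algebras:
compatible families of invariant polynomial functions, of bounded degree. -/
def LULimit (k : ℕ) : Subalgebra ℂ (∀ n : Fin k → ℕ, StateSpace n → ℂ) where
  carrier := {f | (∀ n, f n ∈ LUInvariant n) ∧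
    (∀ (n n' : Fin k → ℕ) (h : n ≤ n'), f n = f n' ∘ stateIncl h) ∧
    ∃ N : ℕ, ∀ n, f n ∈ polyFunLE (StateSpace n) N}
  mul_mem' := by
    rintro f g ⟨h1, h2, N, h3⟩ ⟨h1', h2', M, h3'⟩
    refine ⟨fun n => mul_mem (h1 n) (h1' n), fun n n' h => ?_, N + M, fun n => ?_⟩
    · rw [Pi.mul_apply, Pi.mul_apply, h2 n n' h, h2' n n' h]; rfl
    · rw [polyFunLE, pow_add]
      exact Submodule.mul_mem_mul (h3 n) (h3' n)
  add_mem' := by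
    rintro f g ⟨h1, h2, N, h3⟩ ⟨h1', h2', M, h3'⟩
    refine ⟨fun n => add_mem (h1 n) (h1' n), fun n n' h => ?_, max N M, fun n => ?_⟩
    · rw [Pi.add_apply, Pi.add_apply, h2 n n' h, h2' n n' h]; rfl
    · exact add_mem (polyFunLE_mono _ (le_max_left _ _) (h3 n))
        (polyFunLE_mono _ (le_max_right _ _) (h3' n))
  algebraMap_mem' := by
    intro c
    refine ⟨fun n => algebraMap_mem (LUInvariant n) c, fun n n' h => rfl, 0, fun n => ?_⟩
    rw [polyFunLE, pow_zero]
    exact Submodule.algebraMap_mem c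

/-- The elements of `I_k` that are homogeneous of degree `m` in the coefficients and of degree `m`
in their conjugates. -/
def LULimitHom (k m : ℕ) : Set (∀ n : Fin k → ℕ, StateSpace n → ℂ) :=
  {f | f ∈ LULimit k ∧ ∀ n, f n ∈ biHomogeneous (StateSpace n) m}

/-- The coefficient `ψ_{i_1, …, i_k}` of a state in the standard product basis. -/
noncomputable def coeff {k : ℕ} {n : Fin k → ℕ} (ψ : StateSpace n) (i : ∀ j, Fin (n j)) : ℂ :=
  (Basis.piTensorProduct fun j => Pi.basisFun ℂ (Fin (n j))).repr ψ i

/-- The family of polynomials attached to a tuple `σ_1, …, σ_r` of permutations of `m` letters,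
with `k = r + 1` subsystems; on the last subsystem the permutation is the identity. -/
noncomputable def tupleInvariant {r m : ℕ} (σ : Fin r → Equiv.Perm (Fin m))
    (n : Fin (r + 1) → ℕ) (ψ : StateSpace n) : ℂ :=
  ∑ i : Fin m → ∀ j : Fin (r + 1), Fin (n j),
    (∏ l, coeff ψ (i l)) *
      ∏ l, conj (coeff ψ fun j =>
        i (Fin.snoc (α := fun _ => Equiv.Perm (Fin m)) σ 1 j l) j)

theorem tupleInvariant_conj {r m : ℕ} {σ τ : Fin r → Equiv.Perm (Fin m)}
    (π : Equiv.Perm (Fin m)) (h : ∀ i, σ i = π * τ i * π⁻¹) :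
    tupleInvariant σ = tupleInvariant τ := by
  have hs : ∀ j, Fin.snoc (α := fun _ => Equiv.Perm (Fin m)) σ 1 j =
      π * Fin.snoc (α := fun _ => Equiv.Perm (Fin m)) τ 1 j * π⁻¹ := by
    intro j
    refine Fin.lastCases ?_ (fun i => ?_) j
    · simp
    · simp [h]
  funext n ψ
  refine Fintype.sum_equiv (Equiv.arrowCongr π.symm (Equiv.refl _)) _ _ fun i => ?_
  congr 1
  · exact Fintype.prod_equiv π.symm _ _ fun l => by simp
  · refine Fintype.prod_equiv π.symm _ _ fun l => ?_
    simp [hs, Equiv.Perm.mul_apply, Equiv.Perm.inv_def]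

/-- The invariant `f_s` attached to an orbit `s` of tuples of permutations. -/
noncomputable def orbitInvariant {r : ℕ} (s : Σ m : ℕ, PermOrbit r m) :
    ∀ n : Fin (r + 1) → ℕ, StateSpace n → ℂ :=
  Quotient.lift (fun σ : Fin r → Equiv.Perm (Fin s.1) => tupleInvariant σ) (by
    rintro σ τ ⟨g, hg⟩
    refine tupleInvariant_conj (ConjAct.ofConjAct g) fun i => ?_
    rw [← hg]
    simp [ConjAct.smul_def]) s.2

/-- The set of conjugacy classes of subgroups of index `d` of a group. -/
def subgroupConjClasses (Γ : Type) [Group Γ] (d : ℕ) :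
    Set (MulAction.orbitRel.Quotient (ConjAct Γ) (Subgroup Γ)) :=
  {c | ∃ K : Subgroup Γ, K.index = d ∧ Quotient.mk _ K = c}

/-! A function of bidegree `(m, m)` on the state space is `ψ ↦ ∑ A(I, K) ψ_I conj(ψ_K)` for a kernel
`A` on `m`-tuples of multi-indices. The kernel becomes unique once it is required to be symmetric in
`I` and in `K` separately. Invariance then means that `A` commutes with the tensor powers of local
unitaries. By polynomial continuation `A` commutes with the tensor powers of all local matrices
(`commute_tensorKron_of_unitary`). If every `n_j ≥ m`, such an `A` is a combination of kernels that
permute the `m` copies in each coordinate separately (`mem_span_permKernel`). This is Schur-Weyl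
duality in the stable range, obtained by evaluating at one multi-index with distinct entries.
Multiplying all permutations by a common one does not change the function, so the last permutation
can be taken to be the identity.

The orbit invariants therefore span the invariants of bounded degree for large `n`. They are
linearly independent there, because a multi-index tuple with distinct entries yields a monomial
occurring in exactly one of them (`linearIndepOn_orbitInvariant`). Uniqueness of the coefficients
makes them agree for all `n`, so the orbit invariants form a basis of the inverse limit
(`LULimit_le_span`, `linearIndependent_orbitInvariant`).

Disjoint union of tuples of permutations corresponds to multiplication of invariants
(`vertexInvariant_sum`), and every tuple is a disjoint union of connected ones, so the connected
orbits generate. The multiplicity of a connected orbit in a disjoint union is recovered by counting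
equivariant injections. Hence distinct monomials in the connected invariants are distinct basis
vectors, which is algebraic independence.

A covering of the rose is the same thing as a tuple of permutations of its vertices, and connected
means transitive. A transitive tuple is a transitive action of the free group, classified by the
conjugacy class of a point stabilizer, whose index is the number of points. -/

set_option linter.unusedSectionVars false

/-! ### Kronecker products of families of matrices -/

section PiKron

variable {J : Type} [Fintype J] [DecidableEq J] {κ : J → Type} [∀ j, Fintype (κ j)]
  [∀ j, DecidableEq (κ j)]

/-- The Kronecker product of a family of square matrices. -/
def piKron (X : ∀ j, Matrix (κ j) (κ j) ℂ) : Matrix (∀ j, κ j) (∀ j, κ j) ℂ :=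
  Matrix.of fun i k => ∏ j, X j (i j) (k j)

theorem piKron_apply (X : ∀ j, Matrix (κ j) (κ j) ℂ) (i k : ∀ j, κ j) :
    piKron X i k = ∏ j, X j (i j) (k j) := rfl

theorem piKron_mul (X Y : ∀ j, Matrix (κ j) (κ j) ℂ) :
    piKron (X * Y) = piKron X * piKron Y := by
  ext i k
  simp only [piKron_apply, Pi.mul_apply, Matrix.mul_apply, Fintype.prod_sum,
    Finset.prod_mul_distrib]

theorem piKron_one : piKron (1 : ∀ j, Matrix (κ j) (κ j) ℂ) = 1 := by
  ext i k
  simp only [piKron_apply, Pi.one_apply, Matrix.one_apply, Finset.prod_ite_zero,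
    Finset.prod_const_one, Finset.mem_univ, true_implies, funext_iff]

theorem piKron_conjTranspose (X : ∀ j, Matrix (κ j) (κ j) ℂ) :
    (piKron X).conjTranspose = piKron fun j => (X j).conjTranspose := by
  ext i k
  simp [piKron_apply, Matrix.conjTranspose_apply]

theorem piKron_diagonal (d : ∀ j, κ j → ℂ) :
    piKron (fun j => Matrix.diagonal (d j)) = Matrix.diagonal fun i => ∏ j, d j (i j) := by
  ext i k
  by_cases h : i = k
  · subst h
    simp [piKron_apply]
  · obtain ⟨j, hj⟩ := Function.ne_iff.1 h
    rw [Matrix.diagonal_apply_ne _ h, piKron_apply]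
    exact Finset.prod_eq_zero (Finset.mem_univ j) (Matrix.diagonal_apply_ne _ hj)

/-- The tensor power of a Kronecker product, with factors indexed by `V`. -/
def tensorKron (V : Type) [Fintype V] (X : ∀ j, Matrix (κ j) (κ j) ℂ) :
    Matrix (V → ∀ j, κ j) (V → ∀ j, κ j) ℂ :=
  piKron fun _ : V => piKron X

variable (V : Type) [Fintype V] [DecidableEq V]

theorem tensorKron_mul (X Y : ∀ j, Matrix (κ j) (κ j) ℂ) :
    tensorKron V (X * Y) = tensorKron V X * tensorKron V Y := by
  rw [tensorKron, tensorKron, tensorKron, ← piKron_mul, piKron_mul X Y]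
  rfl

theorem tensorKron_one : tensorKron V (1 : ∀ j, Matrix (κ j) (κ j) ℂ) = 1 := by
  rw [tensorKron, piKron_one]
  exact piKron_one

theorem tensorKron_conjTranspose (X : ∀ j, Matrix (κ j) (κ j) ℂ) :
    (tensorKron V X).conjTranspose = tensorKron V fun j => (X j).conjTranspose := by
  rw [tensorKron, piKron_conjTranspose, piKron_conjTranspose, tensorKron]

theorem tensorKron_diagonal (d : ∀ j, κ j → ℂ) :
    tensorKron V (fun j => Matrix.diagonal (d j)) =
      Matrix.diagonal fun I => ∏ v, ∏ j, d j (I v j) := by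
  rw [tensorKron, piKron_diagonal, piKron_diagonal]

variable {V}

/-- A matrix that commutes with infinitely many members of an affine line of tensor powers
commutes with all of them. -/
theorem commute_tensorKron_line (A : Matrix (V → ∀ j, κ j) (V → ∀ j, κ j) ℂ)
    (S T : ∀ j, Matrix (κ j) (κ j) ℂ) {Z : Set ℂ} (hZ : Z.Infinite)
    (h : ∀ z ∈ Z, Commute (tensorKron V (S + z • T)) A) (z : ℂ) :
    Commute (tensorKron V (S + z • T)) A := by
  -- The entries of the tensor power, and with them those of the commutator, are polynomials in `z`.
  -- The latter vanish on the infinite set `Z`, hence identically.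
  obtain ⟨q, hq⟩ : ∃ q : (V → ∀ j, κ j) → (V → ∀ j, κ j) → Polynomial ℂ,
      ∀ z I K, tensorKron V (S + z • T) I K = (q I K).eval z :=
    ⟨fun I K => ∏ v, ∏ j, (Polynomial.C (S j (I v j) (K v j)) +
      Polynomial.C (T j (I v j) (K v j)) * Polynomial.X), fun z I K => by
      simp [tensorKron, piKron_apply, Polynomial.eval_prod, mul_comm z]⟩
  obtain ⟨p, hp⟩ : ∃ p : (V → ∀ j, κ j) → (V → ∀ j, κ j) → Polynomial ℂ,
      ∀ z I K, (tensorKron V (S + z • T) * A - A * tensorKron V (S + z • T)) I K =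
        (p I K).eval z :=
    ⟨fun I K => ∑ L, q I L * Polynomial.C (A L K) - ∑ L, Polynomial.C (A I L) * q L K,
      fun z I K => by simp [Matrix.mul_apply, hq, Polynomial.eval_finsetSum]⟩
  have hp0 (I K) : p I K = 0 := by
    refine Polynomial.eq_zero_of_infinite_isRoot _ (hZ.mono fun z hz => ?_)
    rw [Set.mem_ofPred_eq, Polynomial.IsRoot.def, ← hp, (h z hz).eq, sub_self, Matrix.zero_apply]
  have hz : tensorKron V (S + z • T) * A - A * tensorKron V (S + z • T) = 0 := by
    ext I K
    rw [hp, hp0, Polynomial.eval_zero, Matrix.zero_apply]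
  exact sub_eq_zero.1 hz

theorem infinite_setOf_norm_eq_one : {z : ℂ | ‖z‖ = 1}.Infinite := by
  refine Set.infinite_of_injOn_mapsTo (s := Set.Icc (-1 : ℝ) 1)
    (f := fun x => (⟨x, Real.sqrt (1 - x ^ 2)⟩ : ℂ)) ?_ ?_ (Set.Icc_infinite (by norm_num))
  · intro x _ y _ h
    exact congrArg Complex.re h
  · intro x hx
    have : 0 ≤ 1 - x ^ 2 := by nlinarith [hx.1, hx.2]
    rw [Set.mem_ofPred_eq, ← sq_eq_sq₀ (norm_nonneg _) zero_le_one, Complex.sq_norm,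
      Complex.normSq_mk, ← sq, ← sq, Real.sq_sqrt this]
    ring

/-- A diagonal matrix is unitary when its entries have modulus one. This constraint is lifted one
entry at a time: with the others fixed, the tensor power runs along an affine line, and the unit
circle is an infinite set of parameters. The induction is on the finite set `s` of entries already
unconstrained. -/
theorem commute_tensorKron_diagonal (A : Matrix (V → ∀ j, κ j) (V → ∀ j, κ j) ℂ)
    (h : ∀ U : ∀ j, Matrix.unitaryGroup (κ j) ℂ, Commute (tensorKron V fun j => (U j).1) A)
    (d : ∀ j, κ j → ℂ) : Commute (tensorKron V fun j => Matrix.diagonal (d j)) A := by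
  suffices H : ∀ (s : Finset (Σ j, κ j)) (d : (Σ j, κ j) → ℂ), (∀ x ∉ s, ‖d x‖ = 1) →
      Commute (tensorKron V fun j => Matrix.diagonal fun a => d ⟨j, a⟩) A from
    H Finset.univ (fun x => d x.1 x.2) fun x hx => absurd (Finset.mem_univ x) hx
  intro s
  induction s using Finset.induction_on with
  | empty =>
    intro d hd
    refine h fun j => ⟨Matrix.diagonal fun a => d ⟨j, a⟩, ?_⟩
    rw [Matrix.mem_unitaryGroup_iff, Matrix.star_eq_conjTranspose, Matrix.diagonal_conjTranspose,
      Matrix.diagonal_mul_diagonal, ← Matrix.diagonal_one]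
    congr 1
    funext a
    simp [Complex.mul_conj, Complex.normSq_eq_norm_sq, hd ⟨j, a⟩ (Finset.notMem_empty _)]
  | insert x s _ ih =>
    intro d hd
    have key (z : ℂ) : (fun j => Matrix.diagonal fun a => Function.update d x z ⟨j, a⟩) =
        (fun j => Matrix.diagonal fun a => Function.update d x 0 ⟨j, a⟩) +
        z • fun j => Matrix.diagonal fun a => (Pi.single x 1 : (Σ j, κ j) → ℂ) ⟨j, a⟩ := by
      funext j
      rw [Pi.add_apply, Pi.smul_apply, ← Matrix.diagonal_smul, Matrix.diagonal_add]
      congr 1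
      funext a
      by_cases ha : (⟨j, a⟩ : Σ j, κ j) = x <;> simp [ha]
    have := commute_tensorKron_line A _ _ infinite_setOf_norm_eq_one (fun z hz => by
      rw [← key]
      refine ih (Function.update d x z) fun y hy => ?_
      by_cases hyx : y = x
      · subst hyx; simpa using hz
      · rw [Function.update_of_ne hyx]
        exact hd y (by simp [hyx, hy])) (d x)
    rwa [← key, Function.update_eq_self] at this

/-- A matrix that commutes with the tensor powers of the local unitary matrices commutes with the
tensor powers of all local matrices. -/
theorem commute_tensorKron_of_unitary (A : Matrix (V → ∀ j, κ j) (V → ∀ j, κ j) ℂ)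
    (h : ∀ U : ∀ j, Matrix.unitaryGroup (κ j) ℂ, Commute (tensorKron V fun j => (U j).1) A)
    (X : ∀ j, Matrix (κ j) (κ j) ℂ) : Commute (tensorKron V X) A := by
  -- Hermitian matrices are unitarily diagonalizable, so the diagonal case covers them.
  have herm (X : ∀ j, Matrix (κ j) (κ j) ℂ) (hX : ∀ j, (X j).IsHermitian) :
      Commute (tensorKron V X) A := by
    have : X = (fun j => ((hX j).eigenvectorUnitary).1) *
        ((fun j => Matrix.diagonal (RCLike.ofReal ∘ (hX j).eigenvalues)) *
          fun j => (star (hX j).eigenvectorUnitary).1) := by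
      funext j
      conv_lhs => rw [(hX j).spectral_theorem, Unitary.conjStarAlgAut_apply]
      rw [mul_assoc]
      rfl
    rw [this, tensorKron_mul, tensorKron_mul]
    exact (h _).mul_left ((commute_tensorKron_diagonal A h _).mul_left (h _))
  have hR : (Set.range ((↑) : ℝ → ℂ)).Infinite :=
    Set.infinite_range_of_injective Complex.ofReal_injective
  -- For real `t` the matrices `Re X + t Im X` are Hermitian; continuing along this line to `t = i`
  -- reaches `X`.
  have := commute_tensorKron_line A (fun j => (realPart (X j) : Matrix (κ j) (κ j) ℂ))
    (fun j => (imaginaryPart (X j) : Matrix (κ j) (κ j) ℂ)) hR (by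
      rintro _ ⟨t, rfl⟩
      refine herm _ fun j => ?_
      have ht : IsSelfAdjoint (t : ℂ) := Complex.conj_ofReal t
      exact ((realPart (X j)).2.add (ht.smul (imaginaryPart (X j)).2) :)) Complex.I
  convert this using 2
  funext j
  exact (realPart_add_I_smul_imaginaryPart (X j)).symm

end PiKron

/-! ### Polynomials in complex variables and their conjugates -/

/-- A polynomial in variables and their conjugates that vanishes as a function is zero. -/
theorem MvPolynomial.eq_zero_of_eval_conj {ι : Type} (p : MvPolynomial (ι ⊕ ι) ℂ)
    (h : ∀ z : ι → ℂ, eval (Sum.elim z fun i => conj (z i)) p = 0) : p = 0 := by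
  -- The substitution `z = x + iy`, `conj z = x - iy` turns `p` into a polynomial in `x` and `y`
  -- that vanishes at all real points, hence is zero.
  let g : ι ⊕ ι → MvPolynomial (ι ⊕ ι) ℂ :=
    Sum.elim (fun i => X (Sum.inl i) + C Complex.I * X (Sum.inr i))
      (fun i => X (Sum.inl i) - C Complex.I * X (Sum.inr i))
  have heval (x : ι ⊕ ι → ℂ) : eval x (aeval g p) =
      eval (Sum.elim (fun i => x (Sum.inl i) + Complex.I * x (Sum.inr i))
        (fun i => x (Sum.inl i) - Complex.I * x (Sum.inr i))) p := by
    rw [aeval_def, eval_eval₂]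
    have hid : (eval x).comp (algebraMap ℂ (MvPolynomial (ι ⊕ ι) ℂ)) = RingHom.id ℂ := by
      ext
      simp
    rw [hid, eval₂_id]
    congr 2
    funext i
    rcases i with i | i <;> simp [g]
  have hq : aeval g p = 0 := by
    refine funext_set (fun _ => Set.range ((↑) : ℝ → ℂ))
      (fun _ => Set.infinite_range_of_injective Complex.ofReal_injective) fun x hx => ?_
    choose y hy using fun i => hx i (Set.mem_univ i)
    rw [heval, map_zero, ← h fun i => x (Sum.inl i) + Complex.I * x (Sum.inr i)]
    congr 2
    funext i
    rcases i with i | i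
    · rfl
    · simp [← hy, sub_eq_add_neg]
  -- The substitution is invertible over the complex numbers, so `p` vanishes at an arbitrary `w`,
  -- not only at conjugate pairs.
  refine MvPolynomial.funext fun w => ?_
  have := heval (Sum.elim (fun i => (w (Sum.inl i) + w (Sum.inr i)) / 2)
    fun i => (w (Sum.inl i) - w (Sum.inr i)) / (2 * Complex.I))
  rw [hq, map_zero] at this
  rw [map_zero, this]
  congr 2
  funext i
  rcases i with i | i
  · simp only [Sum.elim_inl, Sum.elim_inr]
    field_simp [Complex.I_ne_zero]
    ring
  · simp only [Sum.elim_inl, Sum.elim_inr]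
    field_simp [Complex.I_ne_zero]
    ring

/-! ### Functions given by kernels on tensor powers. -/

section Kernel

variable {V W ι : Type} [Fintype V] [Fintype W] [Fintype ι] [DecidableEq ι]

/-- The exponent of the monomial with variables `I v` and conjugate variables `K v`. -/
noncomputable def pairExponent (I K : V → ι) : ι ⊕ ι →₀ ℕ :=
  ∑ v, Finsupp.single (Sum.inl (I v)) 1 + ∑ v, Finsupp.single (Sum.inr (K v)) 1

theorem eval_monomial_pairExponent (I K : V → ι) (c : ℂ) (z w : ι → ℂ) :
    MvPolynomial.eval (Sum.elim z w) (MvPolynomial.monomial (pairExponent I K) c) =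
      c * ((∏ v, z (I v)) * ∏ v, w (K v)) := by
  rw [pairExponent, ← mul_one c, ← MvPolynomial.C_mul_monomial, ← one_mul (1 : ℂ),
    ← MvPolynomial.monomial_mul, MvPolynomial.monomial_sum_one, MvPolynomial.monomial_sum_one]
  simp [MvPolynomial.eval_monomial]

theorem exists_equiv_of_card_fiber_eq {I : V → ι} {K : W → ι}
    (h : ∀ a, (Finset.univ.filter fun v => I v = a).card =
      (Finset.univ.filter fun v => K v = a).card) : ∃ π : V ≃ W, I = K ∘ π := by
  have e (a : ι) : Nonempty ({v // I v = a} ≃ {v // K v = a}) := by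
    refine Fintype.card_eq.1 ?_
    rw [Fintype.card_subtype, Fintype.card_subtype, h]
  refine ⟨Equiv.ofFiberEquiv fun a => (e a).some, funext fun v => ?_⟩
  exact (Equiv.ofFiberEquiv_map _ v).symm

/-- The exponents count how often each index occurs among the variables and among the conjugate
variables. Tuples with equal counts differ by a bijection of their positions, found independently
for the two groups. -/
theorem exists_equiv_of_pairExponent_eq {I K : V → ι} {I' K' : W → ι}
    (h : pairExponent I K = pairExponent I' K') :
    (∃ π : V ≃ W, I = I' ∘ π) ∧ ∃ ρ : V ≃ W, K = K' ∘ ρ := by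
  constructor <;> refine exists_equiv_of_card_fiber_eq fun a => ?_
  · have := DFunLike.congr_fun h (Sum.inl a)
    simp only [pairExponent, Finsupp.add_apply, Finsupp.finsetSum_apply, Finsupp.single_apply,
      Sum.inl.injEq, reduceCtorEq, if_false, Finset.sum_const_zero, add_zero] at this
    rw [Finset.card_filter, Finset.card_filter, this]
  · have := DFunLike.congr_fun h (Sum.inr a)
    simp only [pairExponent, Finsupp.add_apply, Finsupp.finsetSum_apply, Finsupp.single_apply,
      Sum.inr.injEq, reduceCtorEq, if_false, Finset.sum_const_zero, zero_add] at this
    rw [Finset.card_filter, Finset.card_filter, this]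

/-- The function `∑ A(I, K) z_I conj(z_K)`. -/
noncomputable def kernelFun [DecidableEq V] (A : Matrix (V → ι) (V → ι) ℂ) (z : ι → ℂ) : ℂ :=
  ∑ I, ∑ K, A I K * ((∏ v, z (I v)) * ∏ v, conj (z (K v)))

/-- The polynomial that represents `kernelFun A`. -/
noncomputable def kernelPoly [DecidableEq V] (A : Matrix (V → ι) (V → ι) ℂ) :
    MvPolynomial (ι ⊕ ι) ℂ :=
  ∑ I, ∑ K, MvPolynomial.monomial (pairExponent I K) (A I K)

variable [DecidableEq V] [DecidableEq W]

theorem eval_kernelPoly (A : Matrix (V → ι) (V → ι) ℂ) (z : ι → ℂ) :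
    MvPolynomial.eval (Sum.elim z fun i => conj (z i)) (kernelPoly A) = kernelFun A z := by
  simp only [kernelPoly, kernelFun, map_sum, eval_monomial_pairExponent]

/-- A kernel that is symmetric in both groups of arguments is determined by its function. -/
theorem kernel_eq_of_kernelFun_eq {A B : Matrix (V → ι) (V → ι) ℂ}
    (hA : ∀ (π ρ : Equiv.Perm V) I K, A (I ∘ π) (K ∘ ρ) = A I K)
    (hB : ∀ (π ρ : Equiv.Perm V) I K, B (I ∘ π) (K ∘ ρ) = B I K)
    (h : ∀ z, kernelFun A z = kernelFun B z) : A = B := by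
  have hp : kernelPoly (A - B) = 0 := by
    refine MvPolynomial.eq_zero_of_eval_conj _ fun z => ?_
    have := sub_eq_zero.2 (h z)
    rw [eval_kernelPoly, ← this]
    simp only [kernelFun, Matrix.sub_apply, sub_mul, Finset.sum_sub_distrib]
  ext I₀ K₀
  have hc := congrArg (MvPolynomial.coeff (pairExponent I₀ K₀)) hp
  simp only [kernelPoly, MvPolynomial.coeff_sum, MvPolynomial.coeff_monomial,
    MvPolynomial.coeff_zero] at hc
  -- By symmetry all terms contributing to this monomial have the same coefficient, so its total
  -- coefficient is a positive multiple of `(A - B) I₀ K₀`.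
  have hsum : ∀ I K, (if pairExponent I K = pairExponent I₀ K₀ then (A - B) I K else 0) =
      if pairExponent I K = pairExponent I₀ K₀ then (A - B) I₀ K₀ else 0 := by
    intro I K
    split_ifs with h
    · obtain ⟨⟨π, rfl⟩, ρ, rfl⟩ := exists_equiv_of_pairExponent_eq h
      simp [hA, hB]
    · rfl
  simp only [hsum] at hc
  rw [← Fintype.sum_prod_type', ← Finset.sum_filter, Finset.sum_const, nsmul_eq_mul,
    mul_eq_zero, Nat.cast_eq_zero, Finset.card_eq_zero] at hc
  rcases hc with hc | hc
  · exact absurd hc (Finset.Nonempty.ne_empty ⟨(I₀, K₀), by simp⟩)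
  · exact sub_eq_zero.1 hc

theorem kernelFun_smul (c : ℂ) (A : Matrix (V → ι) (V → ι) ℂ) :
    kernelFun (c • A) = c • kernelFun A := by
  funext z
  simp only [kernelFun, Pi.smul_apply, Matrix.smul_apply, smul_eq_mul, Finset.mul_sum, mul_assoc]

theorem kernelFun_add (A B : Matrix (V → ι) (V → ι) ℂ) :
    kernelFun (A + B) = kernelFun A + kernelFun B := by
  funext z
  simp only [kernelFun, Pi.add_apply, Matrix.add_apply, add_mul, Finset.sum_add_distrib]

theorem kernelFun_sum {S : Type} (s : Finset S) (A : S → Matrix (V → ι) (V → ι) ℂ) :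
    kernelFun (∑ x ∈ s, A x) = ∑ x ∈ s, kernelFun (A x) :=
  map_sum (AddMonoidHom.mk' kernelFun kernelFun_add) A s

/-- Every kernel function is given by a symmetric kernel. -/
theorem exists_symmetric_kernel (A : Matrix (V → ι) (V → ι) ℂ) :
    ∃ B : Matrix (V → ι) (V → ι) ℂ,
      (∀ (π ρ : Equiv.Perm V) I K, B (I ∘ π) (K ∘ ρ) = B I K) ∧ kernelFun B = kernelFun A := by
  -- Average over all pairs of permutations; each summand has the same function, since the variables
  -- within a product commute.
  set N : ℂ := (Fintype.card (Equiv.Perm V × Equiv.Perm V) : ℂ) with hN'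
  have hN : N ≠ 0 := Nat.cast_ne_zero.2 Fintype.card_ne_zero
  refine ⟨N⁻¹ • ∑ p : Equiv.Perm V × Equiv.Perm V, A.submatrix (· ∘ p.1) (· ∘ p.2),
    fun π ρ I K => ?_, ?_⟩
  · simp only [Matrix.smul_apply, Matrix.sum_apply, Matrix.submatrix_apply]
    congr 1
    exact Fintype.sum_equiv ((Equiv.mulLeft π).prodCongr (Equiv.mulLeft ρ)) _ _ fun p => rfl
  · have key (p : Equiv.Perm V × Equiv.Perm V) :
        kernelFun (A.submatrix (· ∘ p.1) (· ∘ p.2)) = kernelFun A := by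
      funext z
      unfold kernelFun
      refine Fintype.sum_equiv (Equiv.arrowCongr p.1.symm (Equiv.refl ι)) _ _ fun I => ?_
      refine Fintype.sum_equiv (Equiv.arrowCongr p.2.symm (Equiv.refl ι)) _ _ fun K => ?_
      congr 2
      · exact (Equiv.prod_comp p.1 fun v => z (I v)).symm
      · exact (Equiv.prod_comp p.2 fun v => conj (z (K v))).symm
    rw [kernelFun_smul, kernelFun_sum]
    simp only [key, Finset.sum_const, Finset.card_univ]
    rw [← Nat.cast_smul_eq_nsmul ℂ, smul_smul, ← hN', inv_mul_cancel₀ hN, one_smul]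

/-- In this form a linear substitution in `z` acts on the tensor power of `z` and can be moved onto
the kernel by matrix multiplication. -/
theorem kernelFun_eq_dotProduct (A : Matrix (V → ι) (V → ι) ℂ) (z : ι → ℂ) :
    kernelFun A z =
      (fun I : V → ι => ∏ v, z (I v)) ⬝ᵥ A.mulVec (star fun I : V → ι => ∏ v, z (I v)) := by
  simp only [kernelFun, dotProduct, Matrix.mulVec, Finset.mul_sum, Pi.star_apply, star_prod,
    RCLike.star_def]
  exact Finset.sum_congr rfl fun I _ => Finset.sum_congr rfl fun K _ => by ring

theorem prod_mulVec_apply (M : Matrix ι ι ℂ) (z : ι → ℂ) :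
    (fun I : V → ι => ∏ v, M.mulVec z (I v)) =
      (piKron fun _ : V => M).mulVec fun I => ∏ v, z (I v) := by
  funext I
  simp only [Matrix.mulVec, dotProduct, Fintype.prod_sum, piKron_apply, Finset.prod_mul_distrib]

/-- Substituting a linear transformation into a kernel function. -/
theorem kernelFun_mulVec (A : Matrix (V → ι) (V → ι) ℂ) (M : Matrix ι ι ℂ) (z : ι → ℂ) :
    kernelFun A (M.mulVec z) =
      kernelFun ((piKron fun _ : V => M).transpose * A * (piKron fun _ : V => M).map star) z := by
  rw [kernelFun_eq_dotProduct, kernelFun_eq_dotProduct, prod_mulVec_apply]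
  generalize (fun I : V → ι => ∏ v, z (I v)) = y
  generalize (piKron fun _ : V => M) = T
  rw [Matrix.star_mulVec, ← Matrix.mulVec_mulVec, ← Matrix.mulVec_mulVec,
    Matrix.dotProduct_mulVec _ T.transpose, Matrix.vecMul_transpose, ← Matrix.mulVec_transpose]
  rfl

end Kernel

/-! ### Kernels given by permutations -/

section PermKernel

variable {J : Type} [Fintype J] [DecidableEq J] {κ : J → Type} [∀ j, Fintype (κ j)]
  [∀ j, DecidableEq (κ j)] {V : Type} [Fintype V] [DecidableEq V]

/-- Permute the entries of a tuple of multi-indices, in each coordinate separately. -/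
def twist (τ : J → Equiv.Perm V) (I : V → ∀ j, κ j) : V → ∀ j, κ j :=
  fun v j => I (τ j v) j

theorem twist_twist (τ τ' : J → Equiv.Perm V) (I : V → ∀ j, κ j) :
    twist τ (twist τ' I) = twist (τ' * τ) I := rfl

theorem twist_inv_eq_iff (τ : J → Equiv.Perm V) (I K : V → ∀ j, κ j) :
    twist τ⁻¹ K = I ↔ K = twist τ I := by
  constructor
  · rintro rfl
    rw [twist_twist, inv_mul_cancel]
    rfl
  · rintro rfl
    rw [twist_twist, mul_inv_cancel]
    rfl

/-- The kernel of a family of permutations. -/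
def permKernel (τ : J → Equiv.Perm V) : Matrix (V → ∀ j, κ j) (V → ∀ j, κ j) ℂ :=
  Matrix.of fun I K => if K = twist τ I then 1 else 0

theorem kernelFun_permKernel (τ : J → Equiv.Perm V) (z : (∀ j, κ j) → ℂ) :
    kernelFun (permKernel τ) z = ∑ I, (∏ v, z (I v)) * ∏ v, conj (z (twist τ I v)) := by
  simp [kernelFun, permKernel, ite_mul]

/-- The function of a kernel of permutations does not change if all of them are multiplied from the
right by the same permutation. -/
theorem kernelFun_permKernel_mul (τ : J → Equiv.Perm V) (π : Equiv.Perm V) :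
    kernelFun (permKernel (κ := κ) fun j => τ j * π) = kernelFun (permKernel τ) := by
  funext z
  rw [kernelFun_permKernel, kernelFun_permKernel]
  refine Finset.sum_congr rfl fun I _ => ?_
  congr 1
  exact Equiv.prod_comp π fun v => conj (z (twist τ I v))

/-- An entry is a product over positions and coordinates; for each fixed coordinate the factors are
merely reordered. Permutations may therefore differ between coordinates. -/
theorem tensorKron_twist (X : ∀ j, Matrix (κ j) (κ j) ℂ) (τ : J → Equiv.Perm V)
    (I K : V → ∀ j, κ j) :
    tensorKron V X (twist τ I) (twist τ K) = tensorKron V X I K := by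
  simp only [tensorKron, piKron_apply, twist]
  rw [Finset.prod_comm, Finset.prod_comm (s := (Finset.univ : Finset V))]
  exact Finset.prod_congr rfl fun j _ => Equiv.prod_comp (τ j) fun v => X j (I v j) (K v j)

theorem commute_tensorKron_permKernel (X : ∀ j, Matrix (κ j) (κ j) ℂ) (τ : J → Equiv.Perm V) :
    Commute (tensorKron V X) (permKernel τ) := by
  ext I K
  simp only [Matrix.mul_apply, permKernel, Matrix.of_apply, mul_ite, ite_mul, mul_one, one_mul,
    mul_zero, zero_mul]
  simp only [← twist_inv_eq_iff, Finset.sum_ite_eq, Finset.mem_univ, if_true]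
  rw [← tensorKron_twist X τ]
  simp only [twist_inv_eq_iff, Finset.sum_ite_eq', Finset.mem_univ, if_true]
  congr 1
  exact ((twist_inv_eq_iff τ _ K).1 rfl).symm

end PermKernel

/-- In the stable range, a matrix on a tensor power that commutes with all tensor powers of local
matrices is a combination of permutations. -/
theorem mem_span_permKernel {J : Type} [Fintype J] [DecidableEq J] {n : J → ℕ} {m : ℕ}
    (hm : ∀ j, m ≤ n j)
    (A : Matrix (Fin m → ∀ j, Fin (n j)) (Fin m → ∀ j, Fin (n j)) ℂ)
    (h : ∀ X : ∀ j, Matrix (Fin (n j)) (Fin (n j)) ℂ, Commute (tensorKron (Fin m) X) A) :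
    A ∈ Submodule.span ℂ (Set.range fun τ : J → Equiv.Perm (Fin m) =>
      permKernel (κ := fun j => Fin (n j)) τ) := by
  -- In the stable range there is room for `m` distinct entries in every coordinate. The column of
  -- `A` at this single index will determine `A`.
  let I₀ : Fin m → ∀ j, Fin (n j) := fun v j => Fin.castLE (hm j) v
  have hinj : Function.Injective fun τ : J → Equiv.Perm (Fin m) => twist τ I₀ := by
    intro τ τ' hτ
    funext j
    ext v
    have := congrFun (congrFun hτ v) j
    exact congrArg Fin.val (Fin.castLE_injective (hm j) this)
  have hsupp (K) (hK : A K I₀ ≠ 0) : ∃ τ : J → Equiv.Perm (Fin m), twist τ I₀ = K := by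
    have hfib (j : J) : ∃ π : Fin m ≃ Fin m, (fun v => K v j) = (fun v => I₀ v j) ∘ π := by
      refine exists_equiv_of_card_fiber_eq fun a => ?_
      -- This diagonal matrix has weight `2` at the index `a` of coordinate `j` and `1` elsewhere.
      -- Commuting with it forces `K` and `I₀` to contain `a` equally often in that coordinate.
      let d : ∀ j, Fin (n j) → ℂ := Function.update 1 j (Function.update 1 a 2)
      have hd (K : Fin m → ∀ j, Fin (n j)) : ∏ v, ∏ j, d j (K v j) =
          (2 : ℂ) ^ (Finset.univ.filter fun v => K v j = a).card := by
        have (v : Fin m) : ∏ j, d j (K v j) = if K v j = a then 2 else 1 := by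
          rw [Finset.prod_eq_single j]
          · simp [d, Function.update_apply]
          · intro j' _ hj'
            simp [d, hj']
          · simp
        simp only [this, Finset.prod_ite, Finset.prod_const, one_pow, mul_one]
      have := congrFun (congrFun (h fun j => Matrix.diagonal (d j)).eq K) I₀
      rw [tensorKron_diagonal, Matrix.diagonal_mul, Matrix.mul_diagonal, mul_comm,
        mul_right_inj' hK, hd, hd] at this
      exact Nat.pow_right_injective le_rfl (by exact_mod_cast this)
    choose τ hτ using hfib
    exact ⟨τ, funext fun v => funext fun j => (congrFun (hτ j) v).symm⟩
  have key : A = ∑ τ : J → Equiv.Perm (Fin m), A (twist τ I₀) I₀ • permKernel τ⁻¹ := by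
    ext I T
    -- The local matrices send the basis vectors of `I₀` to those of `T`, so the `I₀` column of `A *
    -- tensorKron X` is the `T` column of `A`. They need not be invertible, which is why commutation
    -- with all matrices is required.
    let X : ∀ j, Matrix (Fin (n j)) (Fin (n j)) ℂ := fun j =>
      Matrix.of fun a b => if ∃ v, Fin.castLE (hm j) v = b ∧ a = T v j then 1 else 0
    have hX (K) (τ : J → Equiv.Perm (Fin m)) :
        tensorKron (Fin m) X K (twist τ I₀) = if K = twist τ T then 1 else 0 := by
      simp [tensorKron, piKron_apply, X, twist, I₀, Finset.prod_ite_zero, funext_iff]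
    have := congrFun (congrFun (h X).eq I) I₀
    rw [Matrix.mul_apply, Matrix.mul_apply] at this
    have h1 (K) : tensorKron (Fin m) X K I₀ = if K = T then 1 else 0 := hX K 1
    simp only [h1, mul_ite, mul_one, mul_zero, Finset.sum_ite_eq', Finset.mem_univ, if_true] at this
    rw [← this, Matrix.sum_apply]
    symm
    refine Fintype.sum_of_injective _ hinj _ _ (fun K hK => ?_) fun τ => ?_
    · rw [not_imp_comm.1 (hsupp K) hK, mul_zero]
    · rw [hX, Matrix.smul_apply, permKernel, Matrix.of_apply, smul_eq_mul, mul_comm]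
      congr 1
      simp only [eq_comm (a := T), twist_inv_eq_iff]
  rw [key]
  exact Submodule.sum_mem _ fun τ _ => Submodule.smul_mem _ _ (Submodule.subset_span ⟨_, rfl⟩)

/-! ### Coefficients of states -/

section Coeff

variable {k : ℕ} {n : Fin k → ℕ}

theorem coeff_add (ψ φ : StateSpace n) : coeff (ψ + φ) = coeff ψ + coeff φ := by
  funext i
  simp [coeff]

theorem coeff_smul (c : ℂ) (ψ : StateSpace n) : coeff (c • ψ) = c • coeff ψ := by
  funext i
  simp [coeff]

theorem coeff_tprod (x : ∀ j, Fin (n j) → ℂ) (i : ∀ j, Fin (n j)) :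
    coeff (PiTensorProduct.tprod ℂ x) i = ∏ j, x j (i j) := by
  simp [coeff, Basis.piTensorProduct_repr_tprod_apply]

/-- A coefficient as a linear functional. -/
noncomputable def coeffLin (i : ∀ j, Fin (n j)) : StateSpace n →ₗ[ℂ] ℂ where
  toFun ψ := coeff ψ i
  map_add' ψ φ := congrFun (coeff_add ψ φ) i
  map_smul' c ψ := congrFun (coeff_smul c ψ) i

theorem coeff_surjective (z : (∀ j, Fin (n j)) → ℂ) : ∃ ψ : StateSpace n, coeff ψ = z :=
  ⟨(Basis.piTensorProduct fun j => Pi.basisFun ℂ (Fin (n j))).equivFun.symm z, by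
    funext i
    exact congrFun ((Basis.piTensorProduct fun j =>
      Pi.basisFun ℂ (Fin (n j))).equivFun.apply_symm_apply z) i⟩

theorem coeff_injective : Function.Injective (coeff : StateSpace n → (∀ j, Fin (n j)) → ℂ) :=
  fun _ _ h => (Basis.piTensorProduct fun j => Pi.basisFun ℂ (Fin (n j))).repr.injective
    (Finsupp.ext fun i => congrFun h i)

theorem coeff_act (U : LU n) (ψ : StateSpace n) :
    coeff (U.act ψ) = (piKron fun j => (U j).1).mulVec (coeff ψ) := by
  induction ψ using PiTensorProduct.induction_on with
  | smul_tprod c x =>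
    funext i
    rw [map_smul, coeff_smul, coeff_smul, Matrix.mulVec_smul, Pi.smul_apply, Pi.smul_apply,
      LU.act, PiTensorProduct.map_tprod, coeff_tprod]
    congr 1
    simp only [Matrix.toLin'_apply, Matrix.mulVec, dotProduct, Fintype.prod_sum, coeff_tprod,
      piKron_apply, Finset.prod_mul_distrib]
  | add ψ φ h h' => rw [map_add, coeff_add, coeff_add, Matrix.mulVec_add, h, h']

theorem coeff_stateIncl_castLE {n' : Fin k → ℕ} (h : n ≤ n') (ψ : StateSpace n)
    (i : ∀ j, Fin (n j)) : coeff (stateIncl h ψ) (fun j => Fin.castLE (h j) (i j)) = coeff ψ i := by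
  induction ψ using PiTensorProduct.induction_on with
  | smul_tprod c x =>
    rw [map_smul, coeff_smul, coeff_smul, Pi.smul_apply, Pi.smul_apply, stateIncl,
      PiTensorProduct.map_tprod, coeff_tprod, coeff_tprod]
    congr 1
    exact Finset.prod_congr rfl fun j _ => (Fin.castLE_injective (h j)).extend_apply _ _ _
  | add ψ φ h h' => rw [map_add, coeff_add, coeff_add, Pi.add_apply, Pi.add_apply, h, h']

theorem coeff_stateIncl_of_not_lt {n' : Fin k → ℕ} (h : n ≤ n') (ψ : StateSpace n)
    (i : ∀ j, Fin (n' j)) {j : Fin k} (hj : ¬ (i j : ℕ) < n j) :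
    coeff (stateIncl h ψ) i = 0 := by
  induction ψ using PiTensorProduct.induction_on with
  | smul_tprod c x =>
    rw [map_smul, coeff_smul, Pi.smul_apply, stateIncl, PiTensorProduct.map_tprod, coeff_tprod,
      Finset.prod_eq_zero (Finset.mem_univ j), smul_zero]
    refine Function.extend_apply' _ _ _ ?_
    rintro ⟨a, ha⟩
    exact hj (by rw [← ha]; exact a.2)
  | add ψ φ h h' => rw [map_add, coeff_add, Pi.add_apply, h, h', add_zero]

theorem linForms_eq_span : linForms (StateSpace n) =
    Submodule.span ℂ (Set.range fun i => fun ψ : StateSpace n => coeff ψ i) := by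
  refine le_antisymm ?_ (Submodule.span_le.2 ?_)
  · rintro _ ⟨l, rfl⟩
    let b := Basis.piTensorProduct fun j => Pi.basisFun ℂ (Fin (n j))
    have : (fun ψ => l ψ) = ∑ i, l (b i) • fun ψ : StateSpace n => coeff ψ i := by
      funext ψ
      conv_lhs => rw [← b.sum_repr ψ, map_sum]
      simp only [Finset.sum_apply, Pi.smul_apply, map_smul, smul_eq_mul, mul_comm (l _)]
      rfl
    rw [this]
    exact Submodule.sum_mem _ fun i _ => Submodule.smul_mem _ _ (Submodule.subset_span ⟨i, rfl⟩)
  · rintro _ ⟨i, rfl⟩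
    exact ⟨coeffLin i, rfl⟩

theorem conjForms_eq_span : conjForms (StateSpace n) =
    Submodule.span ℂ (Set.range fun i => fun ψ : StateSpace n => conj (coeff ψ i)) := by
  refine le_antisymm ?_ (Submodule.span_le.2 ?_)
  · rintro _ ⟨l, rfl⟩
    let b := Basis.piTensorProduct fun j => Pi.basisFun ℂ (Fin (n j))
    have : (fun ψ => conj (l ψ)) =
        ∑ i, conj (l (b i)) • fun ψ : StateSpace n => conj (coeff ψ i) := by
      funext ψ
      conv_lhs => rw [← b.sum_repr ψ, map_sum, map_sum]
      simp only [Finset.sum_apply, Pi.smul_apply, map_smul, smul_eq_mul, map_mul,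
        mul_comm (conj (l _))]
      rfl
    rw [this]
    exact Submodule.sum_mem _ fun i _ => Submodule.smul_mem _ _ (Submodule.subset_span ⟨i, rfl⟩)
  · rintro _ ⟨i, rfl⟩
    exact ⟨coeffLin i, rfl⟩

theorem Submodule.prod_mem_pow_card {A ι : Type} [CommSemiring A] [Algebra ℂ A] {M : Submodule ℂ A}
    (s : Finset ι) {x : ι → A} (hx : ∀ i, x i ∈ M) : ∏ i ∈ s, x i ∈ M ^ s.card := by
  classical
  induction s using Finset.induction_on with
  | empty => exact Submodule.one_le.1 le_rfl
  | insert i s hi ih =>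
    rw [Finset.prod_insert hi, Finset.card_insert_of_notMem hi, pow_succ']
    exact Submodule.mul_mem_mul (hx i) ih

theorem kernelFun_mem_biHomogeneous {V : Type} [Fintype V] [DecidableEq V] {m : ℕ}
    (hV : Fintype.card V = m)
    (A : Matrix (V → ∀ j, Fin (n j)) (V → ∀ j, Fin (n j)) ℂ) :
    (fun ψ : StateSpace n => kernelFun A (coeff ψ)) ∈ biHomogeneous (StateSpace n) m := by
  have : (fun ψ : StateSpace n => kernelFun A (coeff ψ)) = ∑ I, ∑ K, A I K •
      ((∏ v, fun ψ : StateSpace n => coeff ψ (I v)) *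
        ∏ v, fun ψ : StateSpace n => conj (coeff ψ (K v))) := by
    funext ψ
    simp [kernelFun, Finset.sum_apply, Finset.prod_apply]
  rw [this]
  refine Submodule.sum_mem _ fun I _ => Submodule.sum_mem _ fun K _ =>
    Submodule.smul_mem _ _ (Submodule.mul_mem_mul ?_ ?_)
  · rw [← hV, ← Finset.card_univ]
    exact Submodule.prod_mem_pow_card _ fun v => ⟨coeffLin (I v), rfl⟩
  · rw [← hV, ← Finset.card_univ]
    exact Submodule.prod_mem_pow_card _ fun v => ⟨coeffLin (K v), rfl⟩

theorem exists_kernel_of_mem_biHomogeneous {m : ℕ} {f : StateSpace n → ℂ}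
    (hf : f ∈ biHomogeneous (StateSpace n) m) :
    ∃ A : Matrix (Fin m → ∀ j, Fin (n j)) (Fin m → ∀ j, Fin (n j)) ℂ,
      f = fun ψ => kernelFun A (coeff ψ) := by
  rw [biHomogeneous, linForms_eq_span, conjForms_eq_span, Submodule.span_pow, Submodule.span_pow,
    Submodule.span_mul_span] at hf
  induction hf using Submodule.span_induction with
  | mem f hf =>
    obtain ⟨f₁, h₁, f₂, h₂, rfl⟩ := Set.mem_mul.1 hf
    obtain ⟨g₁, rfl⟩ := Set.mem_pow.1 h₁
    obtain ⟨g₂, rfl⟩ := Set.mem_pow.1 h₂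
    choose I hI using fun v => (g₁ v).2
    choose K hK using fun v => (g₂ v).2
    refine ⟨Matrix.single I K 1, ?_⟩
    funext ψ
    rw [List.prod_ofFn, List.prod_ofFn]
    simp only [← hI, ← hK]
    simp [kernelFun, Matrix.single_apply, ite_and, Finset.prod_apply]
  | zero => exact ⟨0, by funext ψ; simp [kernelFun]⟩
  | add f g _ _ hf hg =>
    obtain ⟨A, rfl⟩ := hf
    obtain ⟨B, rfl⟩ := hg
    exact ⟨A + B, by funext ψ; rw [kernelFun_add]; rfl⟩
  | smul c f _ hf =>
    obtain ⟨A, rfl⟩ := hf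
    exact ⟨c • A, by funext ψ; rw [kernelFun_smul]; rfl⟩

end Coeff

/-! ### Decomposition into bihomogeneous parts -/

section Bidegree

variable {H : Type} [AddCommGroup H] [Module ℂ H]

/-- The functions that scale with weight `t ^ a * conj t ^ b`. -/
def scalingFun (H : Type) [AddCommGroup H] [Module ℂ H] (a b : ℕ) : Submodule ℂ (H → ℂ) where
  carrier := {f | ∀ (t : ℂ) ψ, f (t • ψ) = t ^ a * conj t ^ b * f ψ}
  add_mem' hf hg t ψ := by rw [Pi.add_apply, Pi.add_apply, hf, hg, mul_add]
  zero_mem' t ψ := by simp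
  smul_mem' c f hf t ψ := by rw [Pi.smul_apply, Pi.smul_apply, hf, smul_eq_mul, smul_eq_mul]; ring

theorem scalingFun_mul (a b c d : ℕ) :
    scalingFun H a b * scalingFun H c d ≤ scalingFun H (a + c) (b + d) := by
  refine Submodule.mul_le.2 fun f hf g hg t ψ => ?_
  rw [Pi.mul_apply, Pi.mul_apply, hf, hg]
  ring

theorem linForms_pow_mul_conjForms_pow_le (a b : ℕ) :
    linForms H ^ a * conjForms H ^ b ≤ scalingFun H a b := by
  have h0 : (1 : Submodule ℂ (H → ℂ)) ≤ scalingFun H 0 0 := by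
    rw [Submodule.one_le]
    intro t ψ
    simp
  have h1 : linForms H ^ a ≤ scalingFun H a 0 := by
    induction a with
    | zero => simpa using h0
    | succ a ih =>
      rw [pow_succ]
      refine (mul_le_mul' ih ?_).trans (scalingFun_mul a 0 1 0)
      rintro _ ⟨l, rfl⟩ t ψ
      simp
  have h2 : conjForms H ^ b ≤ scalingFun H 0 b := by
    induction b with
    | zero => simpa using h0
    | succ b ih =>
      rw [pow_succ]
      refine (mul_le_mul' ih ?_).trans (scalingFun_mul 0 b 0 1)
      rintro _ ⟨l, rfl⟩ t ψ
      simp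
  simpa using (mul_le_mul' h1 h2).trans (scalingFun_mul a 0 0 b)

/-- The square of bidegrees is larger than the triangle `a + b ≤ N`, but only finiteness and the
bound `N` on each degree are used. -/
theorem polyFunLE_le (N : ℕ) : polyFunLE H N ≤
    ⨆ x ∈ Finset.range (N + 1) ×ˢ Finset.range (N + 1), linForms H ^ x.1 * conjForms H ^ x.2 := by
  induction N with
  | zero =>
    rw [polyFunLE, pow_zero]
    exact le_iSup₂_of_le (0, 0) (by simp) (by simp)
  | succ N ih =>
    rw [polyFunLE, pow_succ]
    refine (mul_le_mul_left ih _).trans ?_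
    simp only [Submodule.iSup_mul]
    refine iSup₂_le fun x hx => ?_
    rw [Finset.mem_product, Finset.mem_range, Finset.mem_range] at hx
    rw [Submodule.mul_sup, Submodule.mul_sup, mul_one]
    refine sup_le (sup_le ?_ ?_) ?_
    · exact le_iSup₂_of_le x (by simp; omega) le_rfl
    · exact le_iSup₂_of_le (x.1 + 1, x.2) (by simp; omega) (by rw [pow_succ, mul_right_comm])
    · exact le_iSup₂_of_le (x.1, x.2 + 1) (by simp; omega) (by rw [pow_succ, mul_assoc])

/-- The powers `t ^ a * conj t ^ b` are independent functions: this is the vanishing criterion for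
polynomials in one variable and its conjugate. -/
theorem eq_zero_of_sum_pow_conj (s : Finset (ℕ × ℕ)) (c : ℕ × ℕ → ℂ)
    (h : ∀ t : ℂ, ∑ x ∈ s, t ^ x.1 * conj t ^ x.2 * c x = 0) : ∀ x ∈ s, c x = 0 := by
  let e : ℕ × ℕ → (Unit ⊕ Unit →₀ ℕ) := fun x =>
    Finsupp.single (Sum.inl ()) x.1 + Finsupp.single (Sum.inr ()) x.2
  have he : Function.Injective e := by
    intro x y hxy
    have h1 := DFunLike.congr_fun hxy (Sum.inl ())
    have h2 := DFunLike.congr_fun hxy (Sum.inr ())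
    simp only [e, Finsupp.add_apply, Finsupp.single_apply] at h1 h2
    exact Prod.ext (by simpa using h1) (by simpa using h2)
  have hp : ∑ x ∈ s, MvPolynomial.monomial (e x) (c x) = 0 := by
    refine MvPolynomial.eq_zero_of_eval_conj _ fun z => ?_
    rw [map_sum, ← h (z ())]
    refine Finset.sum_congr rfl fun x _ => ?_
    rw [MvPolynomial.eval_monomial, Finsupp.prod_add_index' (by simp) (fun _ _ _ => pow_add _ _ _),
      Finsupp.prod_single_index (by simp), Finsupp.prod_single_index (by simp)]
    simp [mul_comm]
  intro x hx
  have := congrArg (MvPolynomial.coeff (e x)) hp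
  simpa [MvPolynomial.coeff_sum, MvPolynomial.coeff_monomial, he.eq_iff, hx] using this

end Bidegree

/-! ### Invariants and their kernels -/

section Invariants

variable {k : ℕ} {n : Fin k → ℕ}

/-- Put the scalar in one tensor factor and the identity in the others. This is where at least one
factor is needed. -/
theorem exists_LU_act_eq_smul [NeZero k] (n : Fin k → ℕ) {c : ℂ} (hc : ‖c‖ = 1) :
    ∃ U : LU n, ∀ ψ, U.act ψ = c • ψ := by
  let d : Fin k → ℂ := Function.update 1 0 c
  have hd (j) : d j * conj (d j) = 1 := by
    by_cases hj : j = 0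
    · subst hj
      simp [d, Complex.mul_conj, Complex.normSq_eq_norm_sq, hc]
    · simp [d, hj]
  refine ⟨fun j => ⟨Matrix.diagonal fun _ => d j, ?_⟩, fun ψ => coeff_injective ?_⟩
  · rw [Matrix.mem_unitaryGroup_iff, Matrix.star_eq_conjTranspose, Matrix.diagonal_conjTranspose,
      Matrix.diagonal_mul_diagonal, ← Matrix.diagonal_one]
    congr 1
    funext a
    exact hd j
  · rw [coeff_act, coeff_smul, piKron_diagonal]
    funext i
    rw [Matrix.mulVec_diagonal, Finset.prod_eq_single 0 (by simp +contextual [d]) (by simp)]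
    simp [d]

/-- An invariant polynomial function is the sum of invariant functions that are homogeneous of the
same degree in the coefficients and in their conjugates. -/
theorem exists_biHomogeneous_decomposition [NeZero k] {f : StateSpace n → ℂ} {N : ℕ}
    (hf : ∀ (U : LU n) ψ, f (U.act ψ) = f ψ) (hN : f ∈ polyFunLE (StateSpace n) N) :
    ∃ g : ℕ → StateSpace n → ℂ, (∀ m, g m ∈ biHomogeneous (StateSpace n) m) ∧
      (∀ m ∈ Finset.range (N + 1), ∀ (U : LU n) ψ, g m (U.act ψ) = g m ψ) ∧
      f = ∑ m ∈ Finset.range (N + 1), g m := by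
  obtain ⟨μ, hμ⟩ := (Submodule.mem_iSup_finset_iff_exists_sum _ _).1 (polyFunLE_le N hN)
  set s := Finset.range (N + 1) ×ˢ Finset.range (N + 1)
  have hscale (x : ℕ × ℕ) (t : ℂ) (ψ : StateSpace n) :
      (μ x).1 (t • ψ) = t ^ x.1 * conj t ^ x.2 * (μ x).1 ψ :=
    linForms_pow_mul_conjForms_pow_le _ _ (μ x).2 t ψ
  have hfμ (ψ : StateSpace n) : f ψ = ∑ x ∈ s, (μ x).1 ψ := by
    rw [← hμ, Finset.sum_apply]
  -- Replacing `ψ` by `t • ψ` separates the bidegrees, so invariance of the sum passes to each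
  -- component.
  have hinv (x) (hx : x ∈ s) (U : LU n) (ψ) : (μ x).1 (U.act ψ) = (μ x).1 ψ := by
    refine sub_eq_zero.1 (eq_zero_of_sum_pow_conj s
      (fun x => (μ x).1 (U.act ψ) - (μ x).1 ψ) (fun t => ?_) x hx)
    simp only [mul_sub, ← hscale, ← map_smul, Finset.sum_sub_distrib, ← hfμ]
    rw [hf, sub_self]
  -- A nonzero component of bidegree `(a, b)` that is invariant under unit scalars satisfies `c ^ a
  -- = c ^ b` on the whole circle, so `a = b`.
  have hoff (x) (hx : x ∈ s) (hne : x.1 ≠ x.2) : (μ x).1 = 0 := by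
    funext ψ
    by_contra h0
    have hpow (c : ℂ) (hc : ‖c‖ = 1) : c ^ x.1 = c ^ x.2 := by
      obtain ⟨U, hU⟩ := exists_LU_act_eq_smul n hc
      have h1 := hinv x hx U ψ
      rw [hU, hscale, mul_eq_right₀ h0] at h1
      have h2 : conj c * c = 1 := by
        rw [mul_comm, Complex.mul_conj, Complex.normSq_eq_norm_sq, hc]
        simp
      calc c ^ x.1 = c ^ x.1 * (conj c * c) ^ x.2 := by rw [h2, one_pow, mul_one]
        _ = (c ^ x.1 * conj c ^ x.2) * c ^ x.2 := by rw [mul_pow, mul_assoc]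
        _ = c ^ x.2 := by rw [h1, one_mul]
    have hX : (Polynomial.X ^ x.1 - Polynomial.X ^ x.2 : Polynomial ℂ) = 0 := by
      refine Polynomial.eq_zero_of_infinite_isRoot _ (infinite_setOf_norm_eq_one.mono fun c hc => ?_)
      rw [Set.mem_ofPred_eq, Polynomial.IsRoot.def]
      simp [hpow c hc]
    have := congrArg Polynomial.natDegree (sub_eq_zero.1 hX)
    rw [Polynomial.natDegree_X_pow, Polynomial.natDegree_X_pow] at this
    exact hne this
  refine ⟨fun m => (μ (m, m)).1, fun m => (μ (m, m)).2, fun m hm => hinv _ ?_, ?_⟩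
  · exact Finset.mem_product.2 ⟨hm, hm⟩
  · rw [← hμ, Finset.sum_product]
    refine Finset.sum_congr rfl fun a ha => ?_
    refine Finset.sum_eq_single (f := fun b => ((μ (a, b)).1 : StateSpace n → ℂ)) a
      (fun b hb hab => ?_) (fun h => absurd ha h)
    exact hoff (a, b) (Finset.mem_product.2 ⟨ha, hb⟩) hab.symm

/-- The kernel of an invariant commutes with the tensor powers of local unitaries. -/
theorem commute_of_kernelFun_invariant {V : Type} [Fintype V] [DecidableEq V]
    (A : Matrix (V → ∀ j, Fin (n j)) (V → ∀ j, Fin (n j)) ℂ)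
    (hA : ∀ (π ρ : Equiv.Perm V) I K, A (I ∘ π) (K ∘ ρ) = A I K)
    (h : ∀ (U : LU n) (ψ : StateSpace n), kernelFun A (coeff (U.act ψ)) = kernelFun A (coeff ψ))
    (U : LU n) : Commute (tensorKron V fun j => (U j).1) A := by
  -- Substituting `U` replaces the kernel by `Tᵗ A T̄`. This kernel is again symmetric and has the
  -- same function, so it equals `A`.
  have hT (U : LU n) : (tensorKron V fun j => (U j).1).transpose * A *
      (tensorKron V fun j => (U j).1).map star = A := by
    refine kernel_eq_of_kernelFun_eq (fun π ρ I K => ?_) hA fun z => ?_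
    · set T := tensorKron V fun j => (U j).1
      have hTπ (π : Equiv.Perm V) (I K) : T (I ∘ π) (K ∘ π) = T I K :=
        tensorKron_twist (fun j => (U j).1) (fun _ => π) I K
      let e : Equiv.Perm V → Equiv.Perm (V → ∀ j, Fin (n j)) := fun π =>
        Equiv.arrowCongr π.symm (Equiv.refl _)
      change (T.transpose * A * T.map star).submatrix (e π) (e ρ) I K = _
      rw [← Matrix.submatrix_mul_equiv _ _ _ (e ρ), ← Matrix.submatrix_mul_equiv _ _ _ (e π)]
      have e1 : T.transpose.submatrix (e π) (e π) = T.transpose :=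
        Matrix.ext fun I K => hTπ π K I
      have e2 : A.submatrix (e π) (e ρ) = A := Matrix.ext fun I K => hA π ρ I K
      have e3 : (T.map star).submatrix (e ρ) (e ρ) = T.map star :=
        Matrix.ext fun I K => congrArg star (hTπ ρ I K)
      rw [e1, e2, e3]
    · obtain ⟨ψ, rfl⟩ := coeff_surjective z
      rw [← h U ψ, coeff_act, kernelFun_mulVec]
      rfl
  have hU : tensorKron V (fun j => (U j).1) * (tensorKron V fun j => (U j).1).conjTranspose = 1 := by
    rw [tensorKron_conjTranspose, ← tensorKron_mul, ← tensorKron_one]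
    congr 1
    funext j
    exact Matrix.mem_unitaryGroup_iff.1 (U j).2
  -- For the entrywise conjugate of `U` the identity becomes `T* A T = A`; multiplying by `T` on the
  -- left gives the commutation.
  have hU' := hT fun j => Matrix.UnitaryGroup.map_star (U j)
  have h1 : (tensorKron V fun j => (Matrix.UnitaryGroup.map_star (U j)).1).map star =
      tensorKron V fun j => (U j).1 := by
    ext I K
    simp [tensorKron, piKron_apply]
  have h2 : (tensorKron V fun j => (Matrix.UnitaryGroup.map_star (U j)).1).transpose =
      (tensorKron V fun j => (U j).1).conjTranspose := by
    ext I K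
    simp [tensorKron, piKron_apply]
  rw [h1, h2] at hU'
  change _ * _ = _ * _
  conv_lhs => rw [← hU']
  rw [← mul_assoc, ← mul_assoc, hU, one_mul]

/-- The permutation kernel commutes with `Tᵗ`, and `Tᵗ T̄ = 1` for unitary `T`, so `Tᵗ P T̄ = P`. -/
theorem kernelFun_permKernel_act {V : Type} [Fintype V] [DecidableEq V]
    (τ : Fin k → Equiv.Perm V) (U : LU n) (ψ : StateSpace n) :
    kernelFun (permKernel τ) (coeff (U.act ψ)) = kernelFun (permKernel τ) (coeff ψ) := by
  rw [coeff_act, kernelFun_mulVec]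
  have h1 : (piKron fun _ : V => piKron fun j => (U j).1).transpose =
      tensorKron V fun j => (U j).1.transpose := rfl
  have h2 : (piKron fun _ : V => piKron fun j => (U j).1).map star =
      tensorKron V fun j => (U j).1.map star := by
    ext I K
    simp [tensorKron, piKron_apply]
  have h3 : (tensorKron V fun j => (U j).1.transpose) * (tensorKron V fun j => (U j).1.map star) =
      1 := by
    rw [← tensorKron_mul, ← tensorKron_one]
    congr 1
    funext j
    have := congrArg Matrix.transpose (Matrix.mem_unitaryGroup_iff'.1 (U j).2)
    rwa [Matrix.transpose_mul, Matrix.transpose_one] at this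
  rw [h1, h2, (commute_tensorKron_permKernel _ τ).eq, mul_assoc, h3, mul_one]

end Invariants

/-! ### The invariants attached to tuples of permutations of a finite set -/

section VertexInvariant

variable {r : ℕ}

/-- The invariant attached to a tuple of permutations of a finite set. -/
noncomputable def vertexInvariant {V : Type} [Fintype V] [DecidableEq V]
    (σ : Fin r → Equiv.Perm V) (n : Fin (r + 1) → ℕ) (ψ : StateSpace n) : ℂ :=
  kernelFun (permKernel (Fin.snoc (α := fun _ => Equiv.Perm V) σ 1)) (coeff ψ)

theorem tupleInvariant_eq_vertexInvariant {m : ℕ} (σ : Fin r → Equiv.Perm (Fin m)) :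
    tupleInvariant σ = vertexInvariant σ := by
  funext n ψ
  rw [vertexInvariant, kernelFun_permKernel]
  rfl

theorem vertexInvariant_apply {V : Type} [Fintype V] [DecidableEq V]
    (σ : Fin r → Equiv.Perm V) (n : Fin (r + 1) → ℕ) (ψ : StateSpace n) :
    vertexInvariant σ n ψ = ∑ I : V → ∀ j, Fin (n j), (∏ v, coeff ψ (I v)) *
      ∏ v, conj (coeff ψ (twist (Fin.snoc (α := fun _ => Equiv.Perm V) σ 1) I v)) :=
  kernelFun_permKernel _ _

theorem polyFunLE_le_polyFun (H : Type) [AddCommGroup H] [Module ℂ H] (N : ℕ) {f : H → ℂ}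
    (hf : f ∈ polyFunLE H N) : f ∈ polyFun H := by
  suffices h : polyFunLE H N ≤ Subalgebra.toSubmodule (polyFun H) from h hf
  clear hf
  have h1 : (1 : Submodule ℂ (H → ℂ)) ≤ Subalgebra.toSubmodule (polyFun H) :=
    Submodule.one_le.2 (polyFun H).one_mem
  induction N with
  | zero =>
    rw [polyFunLE, pow_zero]
    exact h1
  | succ N ih =>
    rw [polyFunLE, pow_succ]
    refine Submodule.mul_le.2 fun f hf g hg => (polyFun H).mul_mem (ih hf) ?_
    have : 1 ⊔ linForms H ⊔ conjForms H ≤ Subalgebra.toSubmodule (polyFun H) := by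
      refine sup_le (sup_le h1 fun f hf => ?_) fun f hf => ?_
      · exact Algebra.subset_adjoin (Or.inl hf)
      · exact Algebra.subset_adjoin (Or.inr hf)
    exact this hg

theorem biHomogeneous_le_polyFunLE (H : Type) [AddCommGroup H] [Module ℂ H] (m : ℕ) :
    biHomogeneous H m ≤ polyFunLE H (2 * m) := by
  rw [biHomogeneous, polyFunLE, two_mul, pow_add]
  exact mul_le_mul' (pow_le_pow_left' (le_sup_right.trans le_sup_left) m)
    (pow_le_pow_left' le_sup_right m)

theorem vertexInvariant_mem_biHomogeneous {V : Type} [Fintype V] [DecidableEq V] {m : ℕ}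
    (hV : Fintype.card V = m) (σ : Fin r → Equiv.Perm V) (n : Fin (r + 1) → ℕ) :
    vertexInvariant σ n ∈ biHomogeneous (StateSpace n) m :=
  kernelFun_mem_biHomogeneous hV _

/-- Coefficients of an included state vanish outside the smaller index range, so only the terms of
the smaller sum survive. -/
theorem vertexInvariant_comp_stateIncl {V : Type} [Fintype V] [DecidableEq V]
    (σ : Fin r → Equiv.Perm V) {n n' : Fin (r + 1) → ℕ} (h : n ≤ n') :
    vertexInvariant σ n = vertexInvariant σ n' ∘ stateIncl h := by
  funext ψ
  rw [Function.comp_apply, vertexInvariant_apply, vertexInvariant_apply]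
  refine Fintype.sum_of_injective (fun I v j => Fin.castLE (h j) (I v j)) ?_ _ _ ?_ ?_
  · intro I K hIK
    funext v j
    exact Fin.castLE_injective (h j) (congrFun (congrFun hIK v) j)
  · intro I hI
    have : ∃ v j, ¬ (I v j : ℕ) < n j := by
      by_contra! hlt
      exact hI ⟨fun v j => ⟨I v j, hlt v j⟩, rfl⟩
    obtain ⟨v, j, hvj⟩ := this
    rw [Finset.prod_eq_zero (Finset.mem_univ v) (coeff_stateIncl_of_not_lt h ψ (I v) hvj), zero_mul]
  · intro I
    simp only [coeff_stateIncl_castLE]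
    congr 1
    exact Finset.prod_congr rfl fun v _ => congrArg conj (coeff_stateIncl_castLE h ψ
      (twist (Fin.snoc (α := fun _ => Equiv.Perm V) σ 1) I v)).symm

theorem vertexInvariant_mem_LULimit {V : Type} [Fintype V] [DecidableEq V]
    (σ : Fin r → Equiv.Perm V) : vertexInvariant σ ∈ LULimit (r + 1) := by
  have hle (n) := biHomogeneous_le_polyFunLE _ _ (vertexInvariant_mem_biHomogeneous rfl σ n)
  exact ⟨fun n => ⟨polyFunLE_le_polyFun _ _ (hle n), kernelFun_permKernel_act _⟩,
    fun n n' h => vertexInvariant_comp_stateIncl σ h, 2 * Fintype.card V, hle⟩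

/-- The invariants of two tuples that correspond under a bijection agree. -/
theorem vertexInvariant_congr {V W : Type} [Fintype V] [DecidableEq V] [Fintype W] [DecidableEq W]
    {σ : Fin r → Equiv.Perm V} {τ : Fin r → Equiv.Perm W} (e : V ≃ W)
    (h : ∀ i v, τ i (e v) = e (σ i v)) : vertexInvariant σ = vertexInvariant τ := by
  have hs (j v) : Fin.snoc (α := fun _ => Equiv.Perm W) τ 1 j (e v) =
      e (Fin.snoc (α := fun _ => Equiv.Perm V) σ 1 j v) := by
    refine Fin.lastCases ?_ (fun i => ?_) j
    · simp
    · simp [h]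
  funext n ψ
  rw [vertexInvariant_apply, vertexInvariant_apply]
  refine Fintype.sum_equiv (Equiv.arrowCongr e (Equiv.refl _)) _ _ fun I => ?_
  congr 1
  · exact Fintype.prod_equiv e _ _ fun v => by simp
  · refine Fintype.prod_equiv e _ _ fun v => ?_
    congr 2
    funext j
    simp [twist, hs]

/-- The invariant of a disjoint union is the product of the invariants. -/
theorem vertexInvariant_sum {V W : Type} [Fintype V] [DecidableEq V] [Fintype W] [DecidableEq W]
    (σ : Fin r → Equiv.Perm V) (τ : Fin r → Equiv.Perm W) :
    vertexInvariant (fun i => (σ i).sumCongr (τ i)) = vertexInvariant σ * vertexInvariant τ := by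
  have hl (j v) : Fin.snoc (α := fun _ => Equiv.Perm (V ⊕ W)) (fun i => (σ i).sumCongr (τ i)) 1 j
      (Sum.inl v) = Sum.inl (Fin.snoc (α := fun _ => Equiv.Perm V) σ 1 j v) := by
    refine Fin.lastCases ?_ (fun i => ?_) j <;> simp
  have hr (j v) : Fin.snoc (α := fun _ => Equiv.Perm (V ⊕ W)) (fun i => (σ i).sumCongr (τ i)) 1 j
      (Sum.inr v) = Sum.inr (Fin.snoc (α := fun _ => Equiv.Perm W) τ 1 j v) := by
    refine Fin.lastCases ?_ (fun i => ?_) j <;> simp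
  funext n ψ
  rw [Pi.mul_apply, Pi.mul_apply, vertexInvariant_apply, vertexInvariant_apply,
    vertexInvariant_apply, Fintype.sum_mul_sum, ← Fintype.sum_prod_type']
  refine Fintype.sum_equiv (Equiv.sumArrowEquivProdArrow _ _ _) _ _ fun I => ?_
  have hl' (v : V) : twist (Fin.snoc (α := fun _ => Equiv.Perm (V ⊕ W))
      (fun i => (σ i).sumCongr (τ i)) 1) I (Sum.inl v) =
      twist (Fin.snoc (α := fun _ => Equiv.Perm V) σ 1) (I ∘ Sum.inl) v :=
    funext fun j => congrArg (I · j) (hl j v)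
  have hr' (v : W) : twist (Fin.snoc (α := fun _ => Equiv.Perm (V ⊕ W))
      (fun i => (σ i).sumCongr (τ i)) 1) I (Sum.inr v) =
      twist (Fin.snoc (α := fun _ => Equiv.Perm W) τ 1) (I ∘ Sum.inr) v :=
    funext fun j => congrArg (I · j) (hr j v)
  simp only [Fintype.prod_sum_type, Equiv.sumArrowEquivProdArrow, Equiv.coe_fn_mk, hl', hr',
    Function.comp_apply]
  ring

theorem vertexInvariant_of_isEmpty {V : Type} [Fintype V] [DecidableEq V] [IsEmpty V]
    (σ : Fin r → Equiv.Perm V) : vertexInvariant σ = 1 := by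
  funext n ψ
  simp [vertexInvariant_apply]

theorem orbitInvariant_mk {m : ℕ} (σ : Fin r → Equiv.Perm (Fin m)) :
    orbitInvariant ⟨m, PermOrbit.mk σ⟩ = vertexInvariant σ :=
  tupleInvariant_eq_vertexInvariant σ

theorem exists_eq_mk (s : Σ m : ℕ, PermOrbit r m) :
    ∃ σ : Fin r → Equiv.Perm (Fin s.1), s = ⟨s.1, PermOrbit.mk σ⟩ := by
  obtain ⟨m, s⟩ := s
  induction s using Quotient.inductionOn with
  | h σ => exact ⟨σ, rfl⟩

end VertexInvariant

/-! ### The invariants of orbits form a basis of the inverse limit -/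

section Basis

variable {r : ℕ}

theorem sigma_mk_eq_of_equiv {m m' : ℕ} {σ : Fin r → Equiv.Perm (Fin m)}
    {τ : Fin r → Equiv.Perm (Fin m')} (e : Fin m ≃ Fin m') (h : ∀ i v, τ i (e v) = e (σ i v)) :
    (⟨m, PermOrbit.mk σ⟩ : Σ m : ℕ, PermOrbit r m) = ⟨m', PermOrbit.mk τ⟩ :=
  ColouredGraph.orbit_label_eq (Equiv.refl _) (Equiv.refl _) e σ τ h

theorem exists_equiv_of_sigma_mk_eq {m m' : ℕ} {σ : Fin r → Equiv.Perm (Fin m)}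
    {τ : Fin r → Equiv.Perm (Fin m')}
    (h : (⟨m, PermOrbit.mk σ⟩ : Σ m : ℕ, PermOrbit r m) = ⟨m', PermOrbit.mk τ⟩) :
    ∃ e : Fin m ≃ Fin m', ∀ i v, τ i (e v) = e (σ i v) := by
  obtain rfl : m = m' := congrArg Sigma.fst h
  obtain ⟨g, hg⟩ := Quotient.exact (eq_of_heq (Sigma.mk.inj h).2)
  refine ⟨(ConjAct.ofConjAct g)⁻¹, fun i v => ?_⟩
  have hg : g • τ = σ := hg
  rw [← hg, Pi.smul_apply, ConjAct.smul_def]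
  simp [Equiv.Perm.mul_apply]

/-- A multi-index tuple with pairwise different entries in each coordinate remembers the orbit. -/
theorem sigma_mk_eq_of_pairExponent_eq {m m' : ℕ} {n : Fin (r + 1) → ℕ}
    (σ : Fin r → Equiv.Perm (Fin m)) (τ : Fin r → Equiv.Perm (Fin m'))
    {I₀ : Fin m → ∀ j, Fin (n j)} (hI₀ : ∀ j, Function.Injective fun v => I₀ v j)
    {I : Fin m' → ∀ j, Fin (n j)}
    (h : pairExponent I (twist (Fin.snoc (α := fun _ => Equiv.Perm (Fin m')) τ 1) I) =
      pairExponent I₀ (twist (Fin.snoc (α := fun _ => Equiv.Perm (Fin m)) σ 1) I₀)) :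
    (⟨m', PermOrbit.mk τ⟩ : Σ m : ℕ, PermOrbit r m) = ⟨m, PermOrbit.mk σ⟩ := by
  obtain ⟨⟨π, rfl⟩, ρ, hρ⟩ := exists_equiv_of_pairExponent_eq h
  have key (j v) : π (Fin.snoc (α := fun _ => Equiv.Perm (Fin m')) τ 1 j v) =
      Fin.snoc (α := fun _ => Equiv.Perm (Fin m)) σ 1 j (ρ v) :=
    hI₀ j (congrFun (congrFun hρ v) j)
  -- Both families are the identity in the last coordinate, which forces `π = ρ`; the remaining
  -- coordinates then say that `π` intertwines `τ` and `σ`.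
  have hlast (v) : π v = ρ v := by simpa using key (Fin.last r) v
  refine sigma_mk_eq_of_equiv π fun i v => ?_
  simpa [hlast] using (key i.castSucc v).symm

/-- For each orbit take a tuple of multi-indices with distinct entries in every coordinate, which
exists as the degree is at most every `n_j`. Its monomial occurs in the invariant of this orbit and
in no other. -/
theorem linearIndepOn_orbitInvariant {N : ℕ} {n : Fin (r + 1) → ℕ} (hn : ∀ j, N ≤ n j) :
    LinearIndepOn ℂ (fun s : Σ m : ℕ, PermOrbit r m => orbitInvariant s n) {s | s.1 ≤ N} := by
  rw [linearIndepOn_iff]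
  intro l hl h0
  choose σ hσ using exists_eq_mk (r := r)
  have horb (s) : orbitInvariant s = vertexInvariant (σ s) := by
    conv_lhs => rw [hσ s]
    rw [orbitInvariant_mk]
  let P (s : Σ m : ℕ, PermOrbit r m) :
      MvPolynomial ((∀ j, Fin (n j)) ⊕ (∀ j, Fin (n j))) ℂ :=
    kernelPoly (permKernel (Fin.snoc (α := fun _ => Equiv.Perm (Fin s.1)) (σ s) 1))
  have hP : ∑ s ∈ l.support, l s • P s = 0 := by
    refine MvPolynomial.eq_zero_of_eval_conj _ fun z => ?_
    obtain ⟨ψ, rfl⟩ := coeff_surjective z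
    have := congrFun h0 ψ
    rw [Finsupp.linearCombination_apply, Finsupp.sum, Finset.sum_apply] at this
    rw [map_sum, ← Pi.zero_apply (M := fun _ => ℂ) ψ, ← this]
    refine Finset.sum_congr rfl fun s _ => ?_
    rw [MvPolynomial.smul_eval, eval_kernelPoly, horb]
    rfl
  ext s₀
  by_contra hs₀
  have hs₀' : s₀ ∈ l.support := Finsupp.mem_support_iff.2 hs₀
  have hle : s₀.1 ≤ N := hl hs₀'
  let I₀ : Fin s₀.1 → ∀ j, Fin (n j) := fun v j => Fin.castLE (hle.trans (hn j)) v
  have hI₀ (j) : Function.Injective fun v => I₀ v j := Fin.castLE_injective _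
  let e := pairExponent I₀ (twist (Fin.snoc (α := fun _ => Equiv.Perm (Fin s₀.1)) (σ s₀) 1) I₀)
  -- The coefficient counts index tuples, so there is no cancellation, and for `s₀` it is nonzero
  -- because `I₀` is counted.
  have hcoeff (s) : MvPolynomial.coeff e (P s) = ((Finset.univ.filter fun I =>
      pairExponent I (twist (Fin.snoc (α := fun _ => Equiv.Perm (Fin s.1)) (σ s) 1) I) = e).card :
        ℂ) := by
    simp only [P, kernelPoly, permKernel, Matrix.of_apply, MvPolynomial.coeff_sum,
      MvPolynomial.coeff_monomial]
    rw [Finset.card_filter, Nat.cast_sum]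
    refine Finset.sum_congr rfl fun I _ => ?_
    rw [Finset.sum_eq_single (twist (Fin.snoc (α := fun _ => Equiv.Perm (Fin s.1)) (σ s) 1) I)]
    · simp
    · intro K _ hK
      simp [hK]
    · simp
  have := congrArg (MvPolynomial.coeff e) hP
  rw [MvPolynomial.coeff_sum, Finset.sum_eq_single s₀ _ (absurd hs₀'), MvPolynomial.coeff_smul,
    hcoeff, MvPolynomial.coeff_zero, smul_eq_mul, mul_eq_zero, Nat.cast_eq_zero,
    Finset.card_eq_zero] at this
  · rcases this with h | h
    · exact hs₀ h
    · exact Finset.filter_eq_empty_iff.1 h (Finset.mem_univ I₀) rfl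
  · intro s _ hs
    rw [MvPolynomial.coeff_smul, hcoeff, Finset.card_eq_zero.2, Nat.cast_zero, smul_zero]
    refine Finset.filter_eq_empty_iff.2 fun I _ hI => hs ?_
    rw [hσ s, hσ s₀]
    exact sigma_mk_eq_of_pairExponent_eq (σ s₀) (σ s) hI₀ hI

theorem mem_span_orbitInvariant {N : ℕ} {n : Fin (r + 1) → ℕ} (hn : ∀ j, N ≤ n j)
    {f : StateSpace n → ℂ} (hf : ∀ (U : LU n) ψ, f (U.act ψ) = f ψ)
    (hN : f ∈ polyFunLE (StateSpace n) N) :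
    f ∈ Submodule.span ℂ
      ((fun s : Σ m : ℕ, PermOrbit r m => orbitInvariant s n) '' {s | s.1 ≤ N}) := by
  obtain ⟨g, hg, hinv, rfl⟩ := exists_biHomogeneous_decomposition hf hN
  refine Submodule.sum_mem _ fun m hm => ?_
  have hmN : m ≤ N := Nat.lt_succ_iff.1 (Finset.mem_range.1 hm)
  obtain ⟨A, hA⟩ := exists_kernel_of_mem_biHomogeneous (hg m)
  obtain ⟨B, hB, hBA⟩ := exists_symmetric_kernel A
  have hgB : g m = fun ψ => kernelFun B (coeff ψ) := by rw [hA, hBA]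
  have hcomm := commute_tensorKron_of_unitary B
    (commute_of_kernelFun_invariant B hB fun U ψ => by
      have := hinv m hm U ψ
      rwa [hgB] at this)
  have hspan := mem_span_permKernel (fun j => hmN.trans (hn j)) B hcomm
  rw [hgB]
  clear hcomm hBA hgB hB
  induction hspan using Submodule.span_induction with
  | mem B hB =>
    obtain ⟨τ, rfl⟩ := hB
    -- Right multiplication by the inverse of the last permutation normalizes that permutation to
    -- the identity without changing the function.
    refine Submodule.subset_span ⟨⟨m, PermOrbit.mk fun i : Fin r =>
      τ i.castSucc * (τ (Fin.last r))⁻¹⟩, hmN, ?_⟩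
    funext ψ
    dsimp only
    rw [orbitInvariant_mk, vertexInvariant, ← kernelFun_permKernel_mul τ (τ (Fin.last r))⁻¹]
    congr 2
    funext j
    refine Fin.lastCases ?_ (fun i => ?_) j <;> simp
  | zero =>
    convert Submodule.zero_mem _ using 1
    funext ψ
    simp [kernelFun]
  | add B C _ _ hB hC =>
    rw [kernelFun_add]
    exact Submodule.add_mem _ hB hC
  | smul c B _ hB =>
    rw [kernelFun_smul]
    exact Submodule.smul_mem _ c hB

theorem linearCombination_orbitInvariant_apply (l : (Σ m : ℕ, PermOrbit r m) →₀ ℂ)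
    (n : Fin (r + 1) → ℕ) : Finsupp.linearCombination ℂ orbitInvariant l n =
      Finsupp.linearCombination ℂ (fun s => orbitInvariant s n) l := by
  simp [Finsupp.linearCombination_apply, Finsupp.sum, Finset.sum_apply]

theorem linearIndependent_orbitInvariant :
    LinearIndependent ℂ (orbitInvariant : (Σ m : ℕ, PermOrbit r m) → _) := by
  rw [linearIndependent_iff]
  intro l hl
  let N := l.support.sup Sigma.fst
  refine linearIndepOn_iff.1 (linearIndepOn_orbitInvariant (n := fun _ => N) fun _ => le_rfl) l
    (fun s hs => Finset.le_sup (f := Sigma.fst) hs) ?_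
  rw [← linearCombination_orbitInvariant_apply, hl]
  rfl

theorem orbitInvariant_mem_LULimit (s : Σ m : ℕ, PermOrbit r m) :
    orbitInvariant s ∈ LULimit (r + 1) := by
  obtain ⟨σ, hσ⟩ := exists_eq_mk s
  rw [hσ, orbitInvariant_mk]
  exact vertexInvariant_mem_LULimit σ

theorem linearCombination_comp_stateIncl (l : (Σ m : ℕ, PermOrbit r m) →₀ ℂ)
    {n n' : Fin (r + 1) → ℕ} (h : n ≤ n') :
    Finsupp.linearCombination ℂ (fun s => orbitInvariant s n) l =
      Finsupp.linearCombination ℂ (fun s => orbitInvariant s n') l ∘ stateIncl h := by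
  have (s : Σ m : ℕ, PermOrbit r m) := (orbitInvariant_mem_LULimit s).2.1 n n' h
  funext ψ
  simp [Finsupp.linearCombination_apply, Finsupp.sum, Finset.sum_apply, this]

/-- The degree bound `N` makes every `n ≥ (N, …, N)` stable. The coefficients found at `(N, …, N)`
are unique, so restriction from a larger `n` shows that they are the same there. An arbitrary `n` is
reached by restricting from `n ⊔ n₀`. -/
theorem LULimit_le_span {F : ∀ n : Fin (r + 1) → ℕ, StateSpace n → ℂ} (hF : F ∈ LULimit (r + 1)) :
    F ∈ Submodule.span ℂ (Set.range (orbitInvariant : (Σ m : ℕ, PermOrbit r m) → _)) := by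
  obtain ⟨hinv, hcomp, N, hN⟩ := hF
  have hstable (n : Fin (r + 1) → ℕ) (hn : ∀ j, N ≤ n j) :=
    (Finsupp.mem_span_image_iff_linearCombination ℂ).1
      (mem_span_orbitInvariant hn (hinv n).2 (hN n))
  let n₀ : Fin (r + 1) → ℕ := fun _ => N
  obtain ⟨l, hl, hlF⟩ := hstable n₀ fun _ => le_rfl
  rw [Finsupp.mem_span_range_iff_exists_finsupp]
  refine ⟨l, ?_⟩
  change Finsupp.linearCombination ℂ orbitInvariant l = F
  funext n
  have h₀ : n₀ ≤ n ⊔ n₀ := le_sup_right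
  obtain ⟨l', hl', hlF'⟩ := hstable (n ⊔ n₀) h₀
  have hll' : l' = l := by
    refine sub_eq_zero.1 (linearIndepOn_iff.1 (linearIndepOn_orbitInvariant (n := n₀)
      fun _ => le_rfl) (l' - l) (Submodule.sub_mem _ hl' hl) ?_)
    rw [map_sub, hlF, linearCombination_comp_stateIncl l' h₀, hlF', ← hcomp, sub_self]
  rw [linearCombination_orbitInvariant_apply, linearCombination_comp_stateIncl l
    (le_sup_left : n ≤ n ⊔ n₀), ← hll', hlF', ← hcomp]

end Basis

/-! ### Tuples of permutations with connected graph -/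

section ConnectedTuples

variable {r : ℕ} {V W X : Type}

/-- The directed graph of a tuple of permutations is connected. -/
def IsConnectedTuple (σ : Fin r → Equiv.Perm V) : Prop :=
  ∀ u v, Relation.EqvGen (fun a b => ∃ i, σ i a = b) u v

theorem isPretransitive_closure_iff (σ : Fin r → Equiv.Perm V) :
    MulAction.IsPretransitive (Subgroup.closure (Set.range σ)) V ↔ IsConnectedTuple σ := by
  constructor
  · intro h u v
    obtain ⟨⟨g, hg⟩, rfl⟩ := h.exists_smul_eq u v
    change Relation.EqvGen _ u (g u)
    clear h
    induction hg using Subgroup.closure_induction generalizing u with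
    | mem g hg =>
      obtain ⟨i, rfl⟩ := hg
      exact .rel _ _ ⟨i, rfl⟩
    | one => exact .refl _
    | mul g g' _ _ hg hg' => exact .trans _ _ _ (hg' u) (hg (g' u))
    | inv g _ hg => simpa using (hg (g⁻¹ u)).symm
  · intro h
    refine ⟨fun u v => ?_⟩
    have := h u v
    induction this with
    | rel a b hab =>
      obtain ⟨i, rfl⟩ := hab
      exact ⟨⟨σ i, Subgroup.subset_closure ⟨i, rfl⟩⟩, rfl⟩
    | refl a => exact ⟨1, one_smul _ _⟩
    | symm a b _ h =>
      obtain ⟨g, rfl⟩ := h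
      exact ⟨g⁻¹, inv_smul_smul _ _⟩
    | trans a b c _ _ h h' =>
      obtain ⟨g, rfl⟩ := h
      obtain ⟨g', rfl⟩ := h'
      exact ⟨g' * g, mul_smul _ _ _⟩

theorem IsConnectedTuple.congr {σ : Fin r → Equiv.Perm V} {τ : Fin r → Equiv.Perm W} (e : V ≃ W)
    (h : ∀ i v, τ i (e v) = e (σ i v)) (hσ : IsConnectedTuple σ) : IsConnectedTuple τ := by
  have key (u v : V) (huv : Relation.EqvGen (fun a b => ∃ i, σ i a = b) u v) :
      Relation.EqvGen (fun a b => ∃ i, τ i a = b) (e u) (e v) := by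
    induction huv with
    | rel a b hab =>
      obtain ⟨i, rfl⟩ := hab
      exact .rel _ _ ⟨i, h i a⟩
    | refl a => exact .refl _
    | symm a b _ h => exact .symm _ _ h
    | trans a b c _ _ h h' => exact .trans _ _ _ h h'
  intro u v
  simpa using key _ _ (hσ (e.symm u) (e.symm v))

/-- The injective equivariant maps between two finite sets with tuples of permutations. -/
def equivariantInjections (σ : Fin r → Equiv.Perm X) (τ : Fin r → Equiv.Perm V) : Set (X → V) :=
  {f | Function.Injective f ∧ ∀ i x, τ i (f x) = f (σ i x)}

theorem card_equivariantInjections_congr (σ : Fin r → Equiv.Perm X) {τ : Fin r → Equiv.Perm V}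
    {τ' : Fin r → Equiv.Perm W} (e : V ≃ W) (h : ∀ i v, τ' i (e v) = e (τ i v)) :
    Nat.card (equivariantInjections σ τ) = Nat.card (equivariantInjections σ τ') := by
  refine Nat.card_congr ((Equiv.arrowCongr (Equiv.refl X) e).subtypeEquiv fun f => ?_)
  refine and_congr (Equiv.comp_injective f e).symm (forall₂_congr fun i x => ?_)
  simp [h]

/-- The image of a connected set lies in one of the two summands, and in only one since `X` is
nonempty. -/
theorem card_equivariantInjections_sum [Finite X] [Finite V] [Finite W] [Nonempty X]
    {σ : Fin r → Equiv.Perm X} (hσ : IsConnectedTuple σ) (τ : Fin r → Equiv.Perm V)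
    (τ' : Fin r → Equiv.Perm W) :
    Nat.card (equivariantInjections σ fun i => (τ i).sumCongr (τ' i)) =
      Nat.card (equivariantInjections σ τ) + Nat.card (equivariantInjections σ τ') := by
  rw [← Nat.card_sum]
  let F : equivariantInjections σ τ ⊕ equivariantInjections σ τ' →
      equivariantInjections σ fun i => (τ i).sumCongr (τ' i) :=
    Sum.elim
      (fun f => ⟨fun x => Sum.inl (f.1 x), Sum.inl_injective.comp f.2.1, fun i x => by
        simp [f.2.2]⟩)
      (fun f => ⟨fun x => Sum.inr (f.1 x), Sum.inr_injective.comp f.2.1, fun i x => by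
        simp [f.2.2]⟩)
  obtain ⟨x₀⟩ := ‹Nonempty X›
  refine (Nat.card_congr (Equiv.ofBijective F ⟨?_, ?_⟩)).symm
  · rintro (⟨f, hf⟩ | ⟨f, hf⟩) (⟨g, hg⟩ | ⟨g, hg⟩) h
    · have this (x) : f x = g x := Sum.inl_injective (congrFun (congrArg Subtype.val h) x)
      congr 2
      exact funext this
    · cases congrFun (congrArg Subtype.val h) x₀
    · cases congrFun (congrArg Subtype.val h) x₀
    · have this (x) : f x = g x := Sum.inr_injective (congrFun (congrArg Subtype.val h) x)
      congr 2
      exact funext this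
  · rintro ⟨f, hf, hfe⟩
    -- The permutations preserve the summands, so the side of `f x` is constant along edges.
    have hside (x) : (f x).isLeft = (f x₀).isLeft := by
      have := hσ x x₀
      induction this with
      | rel a b hab =>
        obtain ⟨i, rfl⟩ := hab
        rw [← hfe]
        cases f a <;> rfl
      | refl a => rfl
      | symm a b _ h => exact h.symm
      | trans a b c _ _ h h' => exact h.trans h'
    cases h₀ : (f x₀).isLeft
    · have this (x) : ∃ y, f x = Sum.inr y := by
        have hx := (hside x).trans h₀
        cases hfx : f x with
        | inl y => simp [hfx] at hx
        | inr y => exact ⟨y, rfl⟩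
      choose g hg using this
      obtain rfl : f = fun x => Sum.inr (g x) := funext hg
      refine ⟨Sum.inr ⟨g, fun x y hxy => hf (congrArg Sum.inr hxy), fun i x => ?_⟩, rfl⟩
      exact Sum.inr_injective (hfe i x)
    · have this (x) : ∃ y, f x = Sum.inl y := by
        have hx := (hside x).trans h₀
        cases hfx : f x with
        | inr y => simp [hfx] at hx
        | inl y => exact ⟨y, rfl⟩
      choose g hg using this
      obtain rfl : f = fun x => Sum.inl (g x) := funext hg
      refine ⟨Sum.inl ⟨g, fun x y hxy => hf (congrArg Sum.inl hxy), fun i x => ?_⟩, rfl⟩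
      exact Sum.inl_injective (hfe i x)

/-- The range is closed under the permutations and their inverses, so it is a union of components.
-/
theorem surjective_of_mem_equivariantInjections [Nonempty X] {σ : Fin r → Equiv.Perm X}
    {τ : Fin r → Equiv.Perm V} (hτ : IsConnectedTuple τ) {f : X → V}
    (hf : f ∈ equivariantInjections σ τ) : Function.Surjective f := by
  obtain ⟨x₀⟩ := ‹Nonempty X›
  have key (u v : V) (huv : Relation.EqvGen (fun a b => ∃ i, τ i a = b) u v) :
      u ∈ Set.range f ↔ v ∈ Set.range f := by
    induction huv with
    | rel a b hab =>
      obtain ⟨i, rfl⟩ := hab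
      constructor
      · rintro ⟨x, rfl⟩
        exact ⟨σ i x, (hf.2 i x).symm⟩
      · rintro ⟨x, hx⟩
        refine ⟨(σ i).symm x, (τ i).injective ?_⟩
        rw [hf.2, Equiv.apply_symm_apply, hx]
    | refl a => rfl
    | symm a b _ h => exact h.symm
    | trans a b c _ _ h h' => exact h.trans h'
  exact fun v => (key _ _ (hτ (f x₀) v)).1 ⟨x₀, rfl⟩

/-- Restricting a tuple of permutations to a connected component. -/
theorem exists_component_splitting (τ : Fin r → Equiv.Perm V) (v : V) :
    ∃ (p : V → Prop) (h : ∀ i x, p (τ i x) ↔ p x), p v ∧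
      IsConnectedTuple (fun i => (τ i).subtypePerm (h i)) := by
  refine ⟨fun x => Relation.EqvGen (fun a b => ∃ i, τ i a = b) v x, fun i x => ⟨fun h => ?_,
    fun h => ?_⟩, .refl _, ?_⟩
  · exact h.trans _ _ _ (.symm _ _ (.rel _ _ ⟨i, rfl⟩))
  · exact h.trans _ _ _ (.rel _ _ ⟨i, rfl⟩)
  · rintro ⟨a, ha⟩ ⟨b, hb⟩
    have hab : Relation.EqvGen (fun a b => ∃ i, τ i a = b) a b := .trans _ _ _ (.symm _ _ ha) hb
    induction hab with
    | rel a b h =>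
      obtain ⟨i, rfl⟩ := h
      exact .rel _ _ ⟨i, rfl⟩
    | refl a => exact .refl _
    | symm a b _ h => exact .symm _ _ (h hb ha)
    | trans a b c hab _ h h' =>
      have hb' := Relation.EqvGen.trans _ _ _ ha hab
      exact .trans _ _ _ (h ha hb') (h' hb' hb)

end ConnectedTuples

/-! ### The invariants of connected tuples are free generators -/

section FreeGenerators

variable {r : ℕ}

/-- A representative of an orbit of tuples of permutations. -/
noncomputable def orbitRep (s : Σ m : ℕ, PermOrbit r m) : Fin r → Equiv.Perm (Fin s.1) :=
  (exists_eq_mk s).choose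

theorem mk_orbitRep (s : Σ m : ℕ, PermOrbit r m) : ⟨s.1, PermOrbit.mk (orbitRep s)⟩ = s :=
  (exists_eq_mk s).choose_spec.symm

theorem orbitInvariant_eq (s : Σ m : ℕ, PermOrbit r m) :
    orbitInvariant s = vertexInvariant (orbitRep s) := by
  rw [← orbitInvariant_mk, mk_orbitRep]

/-- The orbit of a tuple of permutations of an arbitrary finite set. -/
theorem exists_orbit {V : Type} [Fintype V] (τ : Fin r → Equiv.Perm V) :
    ∃ (s : Σ m : ℕ, PermOrbit r m) (e : V ≃ Fin s.1), ∀ i v, orbitRep s i (e v) = e (τ i v) := by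
  let l := Fintype.equivFin V
  let s : Σ m : ℕ, PermOrbit r m := ⟨Fintype.card V, PermOrbit.mk fun i => l.permCongr (τ i)⟩
  obtain ⟨e, he⟩ := exists_equiv_of_sigma_mk_eq (mk_orbitRep s).symm
  refine ⟨s, l.trans e, fun i v => ?_⟩
  rw [Equiv.trans_apply, he]
  simp [Equiv.permCongr_apply]

theorem mem_transitiveOrbits_iff (s : Σ m : ℕ, PermOrbit r m) :
    s ∈ transitiveOrbits r ↔ 1 ≤ s.1 ∧ IsConnectedTuple (orbitRep s) := by
  constructor
  · rintro ⟨m, σ, hm, hσ, hs⟩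
    obtain ⟨e, he⟩ := exists_equiv_of_sigma_mk_eq (hs.symm.trans (mk_orbitRep s).symm)
    refine ⟨by rw [hs]; exact hm, IsConnectedTuple.congr e he ?_⟩
    exact (isPretransitive_closure_iff σ).1 hσ
  · rintro ⟨hs, hσ⟩
    exact ⟨s.1, orbitRep s, hs, (isPretransitive_closure_iff _).2 hσ, (mk_orbitRep s).symm⟩

/-- An equivariant injection between connected tuples is onto, hence an isomorphism. Without
injectivity this fails: a connected covering may map equivariantly onto a smaller one. -/
theorem eq_of_equivariantInjections_nonempty {s t : Σ m : ℕ, PermOrbit r m}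
    (hs : s ∈ transitiveOrbits r) (ht : t ∈ transitiveOrbits r)
    (h : (equivariantInjections (orbitRep s) (orbitRep t)).Nonempty) : s = t := by
  rw [mem_transitiveOrbits_iff] at hs ht
  have : Nonempty (Fin s.1) := ⟨⟨0, hs.1⟩⟩
  obtain ⟨f, hf⟩ := h
  rw [← mk_orbitRep s, ← mk_orbitRep t]
  exact sigma_mk_eq_of_equiv
    (Equiv.ofBijective f ⟨hf.1, surjective_of_mem_equivariantInjections ht.2 hf⟩) hf.2

/-- A monomial in the generators is the invariant of an orbit from which the exponents can be
recovered by counting equivariant injections. -/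
theorem exists_orbit_of_monomial (a : transitiveOrbits r →₀ ℕ) :
    ∃ s : Σ m : ℕ, PermOrbit r m,
      orbitInvariant s = a.prod (fun t k => orbitInvariant t.1 ^ k) ∧
      ∀ t : transitiveOrbits r, Nat.card (equivariantInjections (orbitRep t.1) (orbitRep s)) =
        a t * Nat.card (equivariantInjections (orbitRep t.1) (orbitRep t.1)) := by
  have hne (t : transitiveOrbits r) : Nonempty (Fin t.1.1) :=
    ⟨⟨0, ((mem_transitiveOrbits_iff t.1).1 t.2).1⟩⟩
  have hconn (t : transitiveOrbits r) : IsConnectedTuple (orbitRep t.1) :=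
    ((mem_transitiveOrbits_iff t.1).1 t.2).2
  -- The monomial `1` is the invariant of the empty tuple.
  have hzero : ∃ s : Σ m : ℕ, PermOrbit r m, orbitInvariant s = 1 ∧
      ∀ t : transitiveOrbits r,
        Nat.card (equivariantInjections (orbitRep t.1) (orbitRep s)) = 0 := by
    refine ⟨⟨0, PermOrbit.mk 1⟩, ?_, fun t => ?_⟩
    · rw [orbitInvariant_mk]
      exact vertexInvariant_of_isEmpty _
    · have : IsEmpty (equivariantInjections (orbitRep t.1)
          (orbitRep (⟨0, PermOrbit.mk 1⟩ : Σ m : ℕ, PermOrbit r m))) :=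
        ⟨fun f => (f.1 (hne t).some).elim0⟩
      exact Nat.card_of_isEmpty
  have hadd (a b : transitiveOrbits r →₀ ℕ)
      (ha : ∃ s : Σ m : ℕ, PermOrbit r m,
        orbitInvariant s = a.prod (fun t k => orbitInvariant t.1 ^ k) ∧
        ∀ t : transitiveOrbits r, Nat.card (equivariantInjections (orbitRep t.1) (orbitRep s)) =
          a t * Nat.card (equivariantInjections (orbitRep t.1) (orbitRep t.1)))
      (hb : ∃ s : Σ m : ℕ, PermOrbit r m,
        orbitInvariant s = b.prod (fun t k => orbitInvariant t.1 ^ k) ∧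
        ∀ t : transitiveOrbits r, Nat.card (equivariantInjections (orbitRep t.1) (orbitRep s)) =
          b t * Nat.card (equivariantInjections (orbitRep t.1) (orbitRep t.1))) :
      ∃ s : Σ m : ℕ, PermOrbit r m,
        orbitInvariant s = (a + b).prod (fun t k => orbitInvariant t.1 ^ k) ∧
        ∀ t : transitiveOrbits r, Nat.card (equivariantInjections (orbitRep t.1) (orbitRep s)) =
          (a + b) t * Nat.card (equivariantInjections (orbitRep t.1) (orbitRep t.1)) := by
    obtain ⟨s, hs, hs'⟩ := ha
    obtain ⟨u, hu, hu'⟩ := hb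
    -- The disjoint union multiplies the invariants and adds the counts of injections.
    obtain ⟨w, e, he⟩ := exists_orbit fun i => (orbitRep s i).sumCongr (orbitRep u i)
    refine ⟨w, ?_, fun t => ?_⟩
    · rw [orbitInvariant_eq w, ← vertexInvariant_congr e he, vertexInvariant_sum,
        ← orbitInvariant_eq, ← orbitInvariant_eq, hs, hu, Finsupp.prod_add_index'
        (fun _ => pow_zero _) (fun _ _ _ => pow_add _ _ _)]
    · have := hne t
      rw [← card_equivariantInjections_congr _ e he, card_equivariantInjections_sum (hconn t), hs',
        hu', Finsupp.add_apply, add_mul]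
  induction a using Finsupp.induction_linear with
  | zero => simpa using hzero
  | add a b ha hb => exact hadd a b ha hb
  | single t k =>
    induction k with
    | zero => simpa using hzero
    | succ k ih =>
      rw [Finsupp.single_add]
      refine hadd _ _ ih ⟨t.1, by simp, fun u => ?_⟩
      by_cases hut : u = t
      · subst hut
        simp
      · rw [Finsupp.single_eq_of_ne hut, zero_mul, Nat.card_eq_zero]
        left
        rw [Set.isEmpty_coe_sort, ← Set.not_nonempty_iff_eq_empty]
        exact fun h => hut (Subtype.ext (eq_of_equivariantInjections_nonempty u.2 t.2 h))

/-- Monomials with different exponents belong to different orbits, and invariants of different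
orbits are linearly independent. -/
theorem algebraicIndependent_orbitInvariant :
    AlgebraicIndependent ℂ fun t : transitiveOrbits r => orbitInvariant t.1 := by
  choose D hD hD' using exists_orbit_of_monomial (r := r)
  have hinj : Function.Injective D := by
    intro a b hab
    ext t
    have h := (hD' a t).symm.trans ((by rw [hab]) : _ = _) |>.trans (hD' b t)
    -- The identity is an equivariant injection, so the exponent can be recovered by cancelling this
    -- factor.
    have hpos : 0 < Nat.card (equivariantInjections (orbitRep t.1) (orbitRep t.1)) := by
      have : Nonempty (equivariantInjections (orbitRep t.1) (orbitRep t.1)) :=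
        ⟨⟨id, Function.injective_id, fun _ _ => rfl⟩⟩
      exact Nat.card_pos
    exact Nat.eq_of_mul_eq_mul_right hpos h
  have hli := (linearIndependent_orbitInvariant (r := r)).comp D hinj
  rw [algebraicIndependent_iff]
  intro p hp
  let b := MvPolynomial.basisMonomials (transitiveOrbits r) ℂ
  refine b.repr.map_eq_zero_iff.1 (linearIndependent_iff.1 hli (b.repr p) ?_)
  rw [← hp]
  conv_rhs => rw [← b.linearCombination_repr p]
  rw [← AlgHom.toLinearMap_apply, Finsupp.apply_linearCombination]
  congr 2
  funext a
  simp [b, hD, MvPolynomial.aeval_monomial]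

/-- Split off the component of one vertex: it contributes a generator, and the complement has fewer
vertices. -/
theorem vertexInvariant_mem_adjoin {V : Type} [Fintype V] [DecidableEq V]
    (τ : Fin r → Equiv.Perm V) :
    vertexInvariant τ ∈ Algebra.adjoin ℂ
      (Set.range fun t : transitiveOrbits r => orbitInvariant t.1) := by
  induction hN : Fintype.card V using Nat.strong_induction_on generalizing V with
  | _ N ih =>
    rcases isEmpty_or_nonempty V with hV | ⟨⟨v⟩⟩
    · rw [vertexInvariant_of_isEmpty]
      exact one_mem _
    · classical
      obtain ⟨p, hp, hv, hconn⟩ := exists_component_splitting τ v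
      have hp' (i x) : ¬ p (τ i x) ↔ ¬ p x := not_congr (hp i x)
      have h1 := ih (Fintype.card {x // ¬ p x})
        (hN ▸ Fintype.card_subtype_lt (p := fun x => ¬ p x) (x := v) (not_not.2 hv))
        (fun i => (τ i).subtypePerm (p := fun x => ¬ p x) (hp' i)) rfl
      obtain ⟨s, e, he⟩ := exists_orbit fun i => (τ i).subtypePerm (hp i)
      have hs : s ∈ transitiveOrbits r := by
        rw [mem_transitiveOrbits_iff]
        exact ⟨(e ⟨v, hv⟩).pos, hconn.congr e he⟩
      have h2 : vertexInvariant (fun i => (τ i).subtypePerm (hp i)) ∈ Algebra.adjoin ℂ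
          (Set.range fun t : transitiveOrbits r => orbitInvariant t.1) := by
        rw [vertexInvariant_congr e he, ← orbitInvariant_eq]
        exact Algebra.subset_adjoin ⟨⟨s, hs⟩, rfl⟩
      have h3 : vertexInvariant (fun i => ((τ i).subtypePerm (hp i)).sumCongr
          ((τ i).subtypePerm (p := fun x => ¬ p x) (hp' i))) = vertexInvariant τ := by
        refine vertexInvariant_congr (Equiv.sumCompl p) fun i x => ?_
        rcases x with x | x <;> rfl
      rw [← h3, vertexInvariant_sum]
      exact mul_mem h2 h1

theorem adjoin_orbitInvariant :
    Algebra.adjoin ℂ (Set.range fun t : transitiveOrbits r => orbitInvariant t.1) =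
      LULimit (r + 1) := by
  refine le_antisymm (Algebra.adjoin_le ?_) fun F hF => ?_
  · rintro _ ⟨t, rfl⟩
    exact orbitInvariant_mem_LULimit t.1
  · have hle : Submodule.span ℂ (Set.range (orbitInvariant : (Σ m : ℕ, PermOrbit r m) → _)) ≤
        Subalgebra.toSubmodule (Algebra.adjoin ℂ
          (Set.range fun t : transitiveOrbits r => orbitInvariant t.1)) := by
      rw [Submodule.span_le]
      rintro _ ⟨s, rfl⟩
      rw [orbitInvariant_eq]
      exact vertexInvariant_mem_adjoin _
    exact hle (LULimit_le_span hF)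

end FreeGenerators

/-! ### Coverings of the one-vertex graph and tuples of permutations -/

namespace ColouredGraph

variable {r : ℕ}

theorem Covering.connected_iff (X : Covering (rose r)) :
    X.total.Connected ↔ Nonempty X.total.V ∧ IsConnectedTuple X.monodromy := by
  have : (fun a b => ∃ e, X.total.tail e = a ∧ X.total.head e = b) =
      fun a b => ∃ i, X.monodromy i a = b := by
    funext a b
    refine propext ⟨?_, ?_⟩
    · rintro ⟨e, h1, h2⟩
      exact ⟨X.total.colour e, (X.step_eq_iff _ _ _).2 ⟨e, h1, h2, rfl⟩⟩
    · rintro ⟨i, h⟩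
      obtain ⟨e, h1, h2, -⟩ := (X.step_eq_iff _ _ _).1 h
      exact ⟨e, h1, h2⟩
  rw [Connected, this, IsConnectedTuple]

/-- An edge of a covering of the one-vertex graph is determined by its tail and its colour. -/
noncomputable def Covering.edgeEquiv (X : Covering (rose r)) : X.total.E ≃ X.total.V × Fin r :=
  Equiv.ofBijective (fun e => (X.total.tail e, X.total.colour e)) <| by
    constructor
    · intro e e' h
      obtain ⟨e₀, h₀⟩ := X.exists_out (X.total.colour e) (X.total.tail e)
      have h1 : e ∈ ({e₀} : Set X.total.E) := h₀ ▸ ⟨rfl, rfl⟩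
      have h2 : e' ∈ ({e₀} : Set X.total.E) :=
        h₀ ▸ ⟨(congrArg Prod.fst h).symm, (congrArg Prod.snd h).symm⟩
      rw [Set.mem_singleton_iff.1 h1, Set.mem_singleton_iff.1 h2]
    · rintro ⟨v, i⟩
      obtain ⟨e, h1, -, h2⟩ := (X.step_eq_iff i v _).1 rfl
      exact ⟨e, Prod.ext h1 h2⟩

theorem Covering.head_eq (X : Covering (rose r)) (e : X.total.E) :
    X.total.head e = X.monodromy (X.total.colour e) (X.total.tail e) :=
  ((X.step_eq_iff _ _ _).2 ⟨e, rfl, rfl, rfl⟩).symm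

/-- Edges are pairs of a tail and a colour, so a bijection of vertices extends to edges;
equivariance gives compatibility with heads. The projections are respected because the base has one
vertex and its edges are their colours. -/
theorem Covering.isomorphic_of_monodromy {X Y : Covering (rose r)} (a : X.total.V ≃ Y.total.V)
    (h : ∀ i v, Y.monodromy i (a v) = a (X.monodromy i v)) : X.Isomorphic Y := by
  let b : X.total.E ≃ Y.total.E :=
    (X.edgeEquiv.trans (a.prodCongr (Equiv.refl _))).trans Y.edgeEquiv.symm
  have hb (e) : (Y.total.tail (b e), Y.total.colour (b e)) = (a (X.total.tail e), X.total.colour e) :=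
    Y.edgeEquiv.apply_symm_apply _
  have htail (e) : Y.total.tail (b e) = a (X.total.tail e) := congrArg Prod.fst (hb e)
  have hcol (e) : Y.total.colour (b e) = X.total.colour e := congrArg Prod.snd (hb e)
  refine ⟨a, b, htail, fun e => ?_, hcol, fun v => rfl, fun e => ?_⟩
  · rw [Y.head_eq, X.head_eq, htail, hcol, h]
  · exact (Y.colour_projE (b e)).trans ((hcol e).trans (X.colour_projE e).symm)

theorem Phi_mk (X : FiniteCovering (rose r)) : Phi r (Quotient.mk _ X) =
    ⟨Nat.card X.1.total.V, PermOrbit.mk fun i => X.label.permCongr (X.1.monodromy i)⟩ := rfl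

theorem Phi_injective : Function.Injective (Phi r) := by
  intro c c'
  induction c using Quotient.inductionOn with
  | h X =>
    induction c' using Quotient.inductionOn with
    | h Y =>
      intro h
      obtain ⟨e, he⟩ := exists_equiv_of_sigma_mk_eq h
      refine Quotient.sound (Covering.isomorphic_of_monodromy
        ((X.label.trans e).trans Y.label.symm) fun i v => ?_)
      have := he i (X.label v)
      simp only [Equiv.permCongr_apply, Equiv.symm_apply_apply] at this
      rw [Equiv.trans_apply, Equiv.trans_apply, Equiv.trans_apply, Equiv.trans_apply, ← this,
        Equiv.symm_apply_apply]

/-- The covering of the one-vertex graph defined by a tuple of permutations. -/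
def tupleCovering {V : Type} [Nonempty V] (σ : Fin r → Equiv.Perm V) : Covering (rose r) where
  total :=
    { V := V
      E := V × Fin r
      tail := Prod.fst
      head := fun e => σ e.2 e.1
      colour := Prod.snd }
  projV := fun _ => ()
  projE := Prod.snd
  projV_surjective := fun _ => ⟨Classical.arbitrary V, rfl⟩
  projE_surjective := fun i => ⟨(Classical.arbitrary V, i), rfl⟩
  tail_projE := fun _ => rfl
  head_projE := fun _ => rfl
  colour_projE := fun _ => rfl
  outdegree_eq := fun v c => by
    refine (Set.encard_eq_one.2 ⟨(v, c), ?_⟩).trans (Set.encard_eq_one.2 ⟨c, ?_⟩).symm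
    · ext e
      exact ⟨fun h => Prod.ext h.1 h.2, fun h => ⟨congrArg Prod.fst h, congrArg Prod.snd h⟩⟩
    · ext j
      exact ⟨fun h => h.2, fun h => ⟨rfl, h⟩⟩
  indegree_eq := fun v c => by
    refine (Set.encard_eq_one.2 ⟨((σ c).symm v, c), ?_⟩).trans
      (Set.encard_eq_one.2 ⟨c, ?_⟩).symm
    · ext ⟨a, i⟩
      constructor
      · rintro ⟨h1, h2⟩
        obtain rfl : i = c := h2
        exact Prod.ext ((σ i).eq_symm_apply.2 h1) rfl
      · intro h
        obtain ⟨rfl, rfl⟩ := Prod.mk.inj h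
        exact ⟨(σ i).apply_symm_apply v, rfl⟩
    · ext j
      exact ⟨fun h => h.2, fun h => ⟨rfl, h⟩⟩

theorem tupleCovering_monodromy {V : Type} [Nonempty V] (σ : Fin r → Equiv.Perm V) (i : Fin r)
    (v : V) : (tupleCovering σ).monodromy i v = σ i v :=
  ((tupleCovering σ).step_eq_iff i v _).2 ⟨(v, i), rfl, rfl, rfl⟩

theorem bijOn_Phi : Set.BijOn (Phi r) (Isoc (rose r)) (transitiveOrbits r) := by
  refine ⟨?_, Phi_injective.injOn, ?_⟩
  · rintro _ ⟨X, hX, rfl⟩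
    obtain ⟨hne, hX⟩ := (Covering.connected_iff _).1 hX
    have := X.finite
    refine ⟨_, _, Nat.card_pos, (isPretransitive_closure_iff _).2 ?_, Phi_mk X⟩
    exact hX.congr X.label fun i v => by simp [Equiv.permCongr_apply]
  · rintro _ ⟨m, σ, hm, hσ, rfl⟩
    have : Nonempty (Fin m) := ⟨⟨0, hm⟩⟩
    have hσ' := (isPretransitive_closure_iff σ).1 hσ
    let X : FiniteCovering (rose r) := ⟨tupleCovering σ, fun v => Set.toFinite (α := Fin m) _⟩
    refine ⟨Quotient.mk _ X, ⟨X, (Covering.connected_iff _).2 ⟨this, ?_⟩, rfl⟩, ?_⟩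
    · exact IsConnectedTuple.congr (Equiv.refl (Fin m)) (tupleCovering_monodromy σ) hσ'
    · rw [Phi_mk]
      exact orbit_label_eq X.label (Equiv.refl (Fin m)) (Equiv.refl (Fin m)) _ σ
        fun i v => (tupleCovering_monodromy σ i v).symm

theorem Phi_fst_of_mem_IsocFold {d : ℕ} {c : Iso (rose r)} (hc : c ∈ IsocFold (rose r) d) :
    (Phi r c).1 = d := by
  obtain ⟨X, -, hd, rfl⟩ := hc
  have := X.finite
  have h : (X.1.projV ⁻¹' {()} : Set X.1.total.V) = Set.univ := Set.eq_univ_of_forall fun _ => rfl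
  have hd := hd ()
  rw [Phi_mk]
  have h2 : (Set.univ : Set X.1.total.V).encard = d := h ▸ hd
  rw [Set.encard_univ, ENat.card_eq_coe_natCard] at h2
  exact_mod_cast h2

end ColouredGraph

/-! ### Degrees -/

section Degree

variable {r : ℕ}

theorem orbitInvariant_mem_LULimitHom_iff (s : Σ m : ℕ, PermOrbit r m) (d : ℕ) :
    orbitInvariant s ∈ LULimitHom (r + 1) d ↔ s.1 = d := by
  constructor
  · rintro ⟨-, hd⟩
    -- At `n = (1, …, 1)` and the state with coefficient `1` every orbit invariant has the value
    -- `1`. Scaling this state by `2` multiplies it by `4 ^ s.1` and by `4 ^ d`, which determines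
    -- the degree.
    let n : Fin (r + 1) → ℕ := fun _ => 1
    obtain ⟨ψ, hψ⟩ := coeff_surjective (n := n) 1
    have h1 : orbitInvariant s n ψ = 1 := by
      rw [orbitInvariant_eq, vertexInvariant_apply, hψ]
      simp [n]
    have hs := linForms_pow_mul_conjForms_pow_le _ _ (hd n) 2 ψ
    have hs' := linForms_pow_mul_conjForms_pow_le _ _
      (vertexInvariant_mem_biHomogeneous (Fintype.card_fin s.1) (orbitRep s) n) 2 ψ
    rw [← orbitInvariant_eq] at hs'
    rw [hs', h1] at hs
    simp only [map_ofNat, mul_one, ← mul_pow] at hs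
    refine Nat.pow_right_injective (show 2 ≤ 2 * 2 by norm_num) ?_
    exact_mod_cast hs
  · rintro rfl
    refine ⟨orbitInvariant_mem_LULimit s, fun n => ?_⟩
    rw [orbitInvariant_eq]
    exact vertexInvariant_mem_biHomogeneous (Fintype.card_fin s.1) (orbitRep s) n

end Degree

/-! ### Subgroups of finite index of the free group -/

section FreeGroup

variable {r : ℕ} {V W : Type}

theorem freeGroup_lift_equivariant {σ : Fin r → Equiv.Perm V} {τ : Fin r → Equiv.Perm W}
    {f : V → W} (h : ∀ i v, τ i (f v) = f (σ i v)) (g : FreeGroup (Fin r)) (v : V) :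
    FreeGroup.lift τ g (f v) = f (FreeGroup.lift σ g v) := by
  induction g using FreeGroup.induction_on generalizing v with
  | C1 => simp
  | of i => simp [h]
  | inv_of i _ =>
    rw [map_inv, map_inv, Equiv.Perm.inv_eq_iff_eq]
    simp [h]
  | mul g g' hg hg' => simp [Equiv.Perm.mul_apply, hg, hg']

theorem isConnectedTuple_iff_lift (σ : Fin r → Equiv.Perm V) :
    IsConnectedTuple σ ↔ ∀ u v, ∃ g, FreeGroup.lift σ g u = v := by
  constructor
  · intro h u v
    have := h u v
    induction this with
    | rel a b hab =>
      obtain ⟨i, rfl⟩ := hab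
      exact ⟨FreeGroup.of i, by simp⟩
    | refl a => exact ⟨1, by simp⟩
    | symm a b _ h =>
      obtain ⟨g, rfl⟩ := h
      exact ⟨g⁻¹, by simp⟩
    | trans a b c _ _ h h' =>
      obtain ⟨g, rfl⟩ := h
      obtain ⟨g', rfl⟩ := h'
      exact ⟨g' * g, by simp [Equiv.Perm.mul_apply]⟩
  · intro h u v
    obtain ⟨g, rfl⟩ := h u v
    clear h
    induction g using FreeGroup.induction_on generalizing u with
    | C1 => exact .refl _
    | of i => exact .rel _ _ ⟨i, by simp⟩
    | inv_of i _ => exact .symm _ _ (.rel _ _ ⟨i, by simp⟩)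
    | mul g g' hg hg' =>
      rw [map_mul, Equiv.Perm.mul_apply]
      exact .trans _ _ _ (hg' u) (hg _)

/-- The stabilizer of a point under the action of the free group given by a tuple of
permutations. -/
def pointStabilizer (σ : Fin r → Equiv.Perm V) (x : V) : Subgroup (FreeGroup (Fin r)) :=
  (MulAction.stabilizer (Equiv.Perm V) x).comap (FreeGroup.lift σ)

theorem mem_pointStabilizer {σ : Fin r → Equiv.Perm V} {x : V} {g : FreeGroup (Fin r)} :
    g ∈ pointStabilizer σ x ↔ FreeGroup.lift σ g x = x := Iff.rfl

theorem index_pointStabilizer {σ : Fin r → Equiv.Perm V} (hσ : IsConnectedTuple σ) (x : V) :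
    (pointStabilizer σ x).index = Nat.card V := by
  let _ : MulAction (FreeGroup (Fin r)) V := MulAction.compHom V (FreeGroup.lift σ)
  have h := MulAction.index_stabilizer (FreeGroup (Fin r)) x
  have ho : MulAction.orbit (FreeGroup (Fin r)) x = Set.univ :=
    Set.eq_univ_of_forall fun v => (isConnectedTuple_iff_lift σ).1 hσ x v
  rw [ho, Set.ncard_univ] at h
  exact h

theorem conj_smul_pointStabilizer (σ : Fin r → Equiv.Perm V) (x : V) (g : FreeGroup (Fin r)) :
    ConjAct.toConjAct g • pointStabilizer σ x = pointStabilizer σ (FreeGroup.lift σ g x) := by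
  ext h
  rw [Subgroup.mem_pointwise_smul_iff_inv_smul_mem, mem_pointStabilizer, mem_pointStabilizer,
    ← ConjAct.toConjAct_inv, ConjAct.toConjAct_smul, inv_inv, map_mul, map_mul, map_inv,
    Equiv.Perm.mul_apply, Equiv.Perm.mul_apply, Equiv.Perm.inv_eq_iff_eq]

theorem pointStabilizer_congr {σ : Fin r → Equiv.Perm V} {τ : Fin r → Equiv.Perm W} {e : V → W}
    (he : Function.Injective e) (h : ∀ i v, τ i (e v) = e (σ i v)) (x : V) :
    pointStabilizer τ (e x) = pointStabilizer σ x := by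
  ext g
  rw [mem_pointStabilizer, mem_pointStabilizer, freeGroup_lift_equivariant h, he.eq_iff]

/-- Transitive actions with a common point stabilizer are isomorphic. -/
theorem exists_equiv_of_pointStabilizer_eq {σ : Fin r → Equiv.Perm V} {τ : Fin r → Equiv.Perm W}
    (hσ : IsConnectedTuple σ) (hτ : IsConnectedTuple τ) {x : V} {y : W}
    (h : pointStabilizer σ x = pointStabilizer τ y) :
    ∃ e : V ≃ W, ∀ i v, τ i (e v) = e (σ i v) := by
  rw [isConnectedTuple_iff_lift] at hσ hτ
  -- Equal stabilizers make `g x ↦ g y` well defined and injective.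
  have key (g g') : FreeGroup.lift σ g x = FreeGroup.lift σ g' x ↔
      FreeGroup.lift τ g y = FreeGroup.lift τ g' y := by
    have := SetLike.ext_iff.1 h (g'⁻¹ * g)
    simpa only [mem_pointStabilizer, map_mul, map_inv, Equiv.Perm.mul_apply,
      Equiv.Perm.inv_eq_iff_eq] using this
  choose γ hγ using hσ x
  have hf (g) : FreeGroup.lift τ (γ (FreeGroup.lift σ g x)) y = FreeGroup.lift τ g y :=
    (key _ _).1 (hγ _)
  refine ⟨Equiv.ofBijective (fun v => FreeGroup.lift τ (γ v) y) ⟨fun u v huv => ?_, fun w => ?_⟩,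
    fun i v => ?_⟩
  · rw [← hγ u, ← hγ v]
    exact (key _ _).2 huv
  · obtain ⟨g, rfl⟩ := hτ y w
    exact ⟨_, hf g⟩
  · obtain ⟨g, rfl⟩ : ∃ g, FreeGroup.lift σ g x = v := ⟨_, hγ v⟩
    have := hf (FreeGroup.of i * g)
    simp only [map_mul, FreeGroup.lift_apply_of, Equiv.Perm.mul_apply] at this
    change τ i (FreeGroup.lift τ (γ _) y) = FreeGroup.lift τ (γ _) y
    rw [hf, this]

/-- The free group acts transitively on the cosets of `K`, and the trivial coset has stabilizer `K`.
-/
theorem exists_pointStabilizer_eq (K : Subgroup (FreeGroup (Fin r))) (hK : K.index ≠ 0) :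
    ∃ s ∈ transitiveOrbits r, s.1 = K.index ∧ ∃ x, pointStabilizer (orbitRep s) x = K := by
  have : K.FiniteIndex := ⟨hK⟩
  have := Fintype.ofFinite (FreeGroup (Fin r) ⧸ K)
  let τ : Fin r → Equiv.Perm (FreeGroup (Fin r) ⧸ K) := fun i =>
    MulAction.toPerm (FreeGroup.of i)
  have hτ : FreeGroup.lift τ = MulAction.toPermHom (FreeGroup (Fin r)) (FreeGroup (Fin r) ⧸ K) :=
    FreeGroup.ext_hom _ _ fun i => by simp [τ]
  have hconn : IsConnectedTuple τ := by
    rw [isConnectedTuple_iff_lift, hτ]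
    exact fun u v => MulAction.exists_smul_eq _ u v
  obtain ⟨s, e, he⟩ := exists_orbit τ
  have hcard : s.1 = K.index := by
    rw [Subgroup.index, Nat.card_congr e, Nat.card_fin]
  refine ⟨s, (mem_transitiveOrbits_iff s).2 ⟨hcard ▸ Nat.one_le_iff_ne_zero.2 hK, hconn.congr e he⟩,
    hcard, e ((1 : FreeGroup (Fin r)) : FreeGroup (Fin r) ⧸ K), ?_⟩
  rw [pointStabilizer_congr e.injective he, pointStabilizer, hτ]
  exact MulAction.stabilizer_quotient K

/-- Transitive orbits of tuples of permutations of `d` letters correspond to conjugacy classes of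
subgroups of index `d` of the free group. -/
theorem ncard_transitiveOrbits {d : ℕ} (hd : 1 ≤ d) :
    {s ∈ transitiveOrbits r | s.1 = d}.Finite ∧
    (subgroupConjClasses (FreeGroup (Fin r)) d).Finite ∧
    {s ∈ transitiveOrbits r | s.1 = d}.ncard =
      (subgroupConjClasses (FreeGroup (Fin r)) d).ncard := by
  have hfin : {s ∈ transitiveOrbits r | s.1 = d}.Finite := by
    refine (Set.finite_range (Sigma.mk (β := PermOrbit r) d)).subset ?_
    rintro ⟨_, o⟩ ⟨-, rfl⟩
    exact ⟨o, rfl⟩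
  let G : (Σ m : ℕ, PermOrbit r m) →
      MulAction.orbitRel.Quotient (ConjAct (FreeGroup (Fin r))) (Subgroup (FreeGroup (Fin r))) :=
    fun s => if h : 0 < s.1 then Quotient.mk _ (pointStabilizer (orbitRep s) ⟨0, h⟩)
      else Quotient.mk _ ⊥
  -- By transitivity the stabilizers of all points are conjugate, so the class does not depend on
  -- the base point.
  have hG {s} (hs : s ∈ transitiveOrbits r) (x) :
      G s = Quotient.mk _ (pointStabilizer (orbitRep s) x) := by
    rw [mem_transitiveOrbits_iff] at hs
    have h0 : 0 < s.1 := hs.1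
    obtain ⟨g, hg⟩ := (isConnectedTuple_iff_lift _).1 hs.2 x ⟨0, h0⟩
    simp only [G, dif_pos h0]
    refine Quotient.sound ⟨ConjAct.toConjAct g, ?_⟩
    change _ • _ = _
    rw [conj_smul_pointStabilizer, hg]
  have hinj : Set.InjOn G {s ∈ transitiveOrbits r | s.1 = d} := by
    rintro s ⟨hs, hsd⟩ t ⟨ht, htd⟩ hst
    have xs : Fin s.1 := ⟨0, hsd ▸ hd⟩
    have xt : Fin t.1 := ⟨0, htd ▸ hd⟩
    rw [hG hs xs, hG ht xt] at hst
    obtain ⟨g, hg⟩ := Quotient.exact hst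
    have hg : g • pointStabilizer (orbitRep t) xt = pointStabilizer (orbitRep s) xs := hg
    rw [← ConjAct.toConjAct_ofConjAct g, conj_smul_pointStabilizer] at hg
    rw [mem_transitiveOrbits_iff] at hs ht
    obtain ⟨e, he⟩ := exists_equiv_of_pointStabilizer_eq ht.2 hs.2 hg
    rw [← mk_orbitRep s, ← mk_orbitRep t]
    exact (sigma_mk_eq_of_equiv e he).symm
  have himage : G '' {s ∈ transitiveOrbits r | s.1 = d} =
      subgroupConjClasses (FreeGroup (Fin r)) d := by
    ext c
    constructor
    · rintro ⟨s, ⟨hs, hsd⟩, rfl⟩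
      have x : Fin s.1 := ⟨0, hsd ▸ hd⟩
      refine ⟨pointStabilizer (orbitRep s) x, ?_, (hG hs x).symm⟩
      rw [index_pointStabilizer ((mem_transitiveOrbits_iff s).1 hs).2, Nat.card_fin, hsd]
    · rintro ⟨K, hK, rfl⟩
      obtain ⟨s, hs, hsK, x, hx⟩ := exists_pointStabilizer_eq K (by omega)
      exact ⟨s, ⟨hs, hsK.trans hK⟩, by rw [hG hs x, hx]⟩
  exact ⟨hfin, himage ▸ hfin.image G, himage ▸ hinj.ncard_image.symm⟩

end FreeGroup

/-! ### The theorem for `k = r + 1`. -/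

theorem mainTheorem1 (r : ℕ) :
    -- `I_k`, `k = r + 1`, is the free commutative algebra on the `f_{Φ(X)}`, `X ∈ Isoc`
    (∃ e : MvPolynomial (ColouredGraph.Isoc (ColouredGraph.rose r)) ℂ ≃ₐ[ℂ] LULimit (r + 1),
      ∀ X, (e (MvPolynomial.X X) : ∀ n : Fin (r + 1) → ℕ, StateSpace n → ℂ) =
        orbitInvariant (ColouredGraph.Phi r X.1)) ∧
    -- the connected coverings correspond to the orbits of transitive tuples
    Set.BijOn (ColouredGraph.Phi r) (ColouredGraph.Isoc (ColouredGraph.rose r))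
      (transitiveOrbits r) ∧
    -- the generator of a `d`-fold covering is homogeneous of degree `d` in the coefficients and
    -- of degree `d` in their conjugates
    (∀ d, ∀ X ∈ ColouredGraph.IsocFold (ColouredGraph.rose r) d,
      orbitInvariant (ColouredGraph.Phi r X) ∈ LULimitHom (r + 1) d) ∧
    -- the number of generators of each degree
    (∀ d, 1 ≤ d →
      ((fun X => orbitInvariant (ColouredGraph.Phi r X)) ''
          ColouredGraph.Isoc (ColouredGraph.rose r) ∩ LULimitHom (r + 1) d).Finite ∧
      (subgroupConjClasses (FreeGroup (Fin r)) d).Finite ∧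
      ((fun X => orbitInvariant (ColouredGraph.Phi r X)) ''
          ColouredGraph.Isoc (ColouredGraph.rose r) ∩ LULimitHom (r + 1) d).ncard =
        (subgroupConjClasses (FreeGroup (Fin r)) d).ncard) := by
  refine ⟨?_, ColouredGraph.bijOn_Phi, fun d X hX => ?_, fun d hd => ?_⟩
  · refine ⟨((MvPolynomial.renameEquiv ℂ (ColouredGraph.bijOn_Phi.equiv _)).trans
      algebraicIndependent_orbitInvariant.aevalEquiv).trans
        (Subalgebra.equivOfEq _ _ adjoin_orbitInvariant), fun X => ?_⟩
    simp only [AlgEquiv.trans_apply, MvPolynomial.renameEquiv_apply, MvPolynomial.rename_X,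
      Subalgebra.equivOfEq_apply, AlgebraicIndependent.aevalEquiv_apply_coe, MvPolynomial.aeval_X]
    rfl
  · rw [orbitInvariant_mem_LULimitHom_iff]
    exact ColouredGraph.Phi_fst_of_mem_IsocFold hX
  · obtain ⟨h1, h2, h3⟩ := ncard_transitiveOrbits (r := r) hd
    have himage : (fun X => orbitInvariant (ColouredGraph.Phi r X)) ''
        ColouredGraph.Isoc (ColouredGraph.rose r) ∩ LULimitHom (r + 1) d =
        orbitInvariant '' {s ∈ transitiveOrbits r | s.1 = d} := by
      rw [← Set.image_image orbitInvariant, ColouredGraph.bijOn_Phi.image_eq]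
      ext F
      constructor
      · rintro ⟨⟨s, hs, rfl⟩, hF⟩
        exact ⟨s, ⟨hs, (orbitInvariant_mem_LULimitHom_iff s d).1 hF⟩, rfl⟩
      · rintro ⟨s, ⟨hs, hsd⟩, rfl⟩
        exact ⟨⟨s, hs, rfl⟩, (orbitInvariant_mem_LULimitHom_iff s d).2 hsd⟩
    rw [himage]
    refine ⟨h1.image _, h2, ?_⟩
    -- Linear independence makes different orbits have different invariants, so counting invariants
    -- is counting orbits.
    rw [Set.ncard_image_of_injective _ linearIndependent_orbitInvariant.injective, h3]
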